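/- All operads are symmetric operads of $\mathbb{Z}$-modules, given by a module $\mathcal{P}(I)$ for every finite non-empty set $I$, functorial in bijections, with a unit in $\mathcal{P}(\{*\})$ and partial compositions $\circ_j:\mathcal{P}(J)\otimes\mathcal{P}(I)\to\mathcal{P}((J\setminus\{j\})\sqcup I)$, $j\in J$; morphisms of operads respect all this structure. A rooted tree on $I$ is a connected graph without cycles on the vertex set $I$ with a distinguished vertex, the root; its edges are oriented towards the root. A planar rooted tree on $I$ is a rooted tree on $I$ together with, for every vertex, a total order (from left to right) on the set of edges entering this vertex. If $j$ is a vertex of a tree $T$, let $\operatorname{Entr}(T,j)$ denote the set of edges of $T$ entering $j$. Let $\operatorname{PreLie}(I)$ be the free $\mathbb{Z}$-module on the (non-planar) rooted trees on $I$, with the composition of Chapoton and Livernet $$T\circ_j S=\sum_{f}T\circ_j^f S,$$ where $f$ runs over all maps from $\operatorname{Entr}(T,j)$ to the set of vertices of $S$, and $T\circ_j^f S$ is obtained by substituting $S$ for the vertex $j$ of $T$, the edges entering $j$ being attached to the vertices of $S$ according to $f$ and the edge leaving $j$ (if any) now leaving the root of $S$. The operation $x_1\circ x_2\in\operatorname{PreLie}(2)$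 is the tree with root $1$ and a single other vertex $2$. Let $\operatorname{Brace}(I)$ be the free $\mathbb{Z}$-module on the planar rooted trees on $I$, with the composition $$T\circ_j S=\sum_{f}T\circ_j^f S,$$ where $f$ runs over all weakly increasing maps from the ordered set $\operatorname{Entr}(T,j)$ to the set of angles of $S$ (an angle is a vertex together with one of the $k+1$ gaps between its $k$ entering edges), ordered from left to right along the contour of $S$, and $T\circ_j^f S$ is obtained by substituting $S$ for $j$, the edges entering $j$ being drawn, in their order, into the angles of $S$ according to $f$. The operation $\{x_1\mid x_2\}\in\operatorname{Brace}(2)$ is the planar tree with root $1$ and a single other vertex $2$. Proposition. $\operatorname{PreLie}$ and $\operatorname{Brace}$ are operads, and there is a unique morphism of operads $\phi:\operatorname{PreLie}\to\operatorname{Brace}$ such that $$\phi(x_1\circ x_2)=\{x_1\mid x_2\}.$$ This morphism is given by symmetrization of trees: if $T$ is a non-planar rooted tree on a finite non-empty set $I$, then $\phi(T)$ is the sum of all planar rooted trees on $I$ that are isomorphic to $T$ as non-planar rooted trees (i.e. whose underlying rooted tree on $I$ is $T$). -/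

import Mathlib

/-! ## Symmetric operads in abelian groups, in partial-composition form -/

/-- The data of a symmetric operad of `ℤ`-modules: a module `obj I` for every finite non-empty set
`I`, the relabelling along bijections, the unit, and the biadditive partial compositions
`a ∘_j b`, where `b` is substituted for the entry `j` of `a`; the entries of `a ∘_j b` form the set
`(J ∖ {j}) ⊔ I`. -/
structure OperadData where
  obj : (I : Type) → [Finite I] → [Nonempty I] → Type
  [grp : (I : Type) → [Finite I] → [Nonempty I] → AddCommGroup (obj I)]
  map : {I J : Type} → [Finite I] → [Nonempty I] → [Finite J] → [Nonempty J] →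
    (I ≃ J) → obj I →+ obj J
  unit : obj Unit
  comp : {I J : Type} → [Finite I] → [Nonempty I] → [Finite J] → [Nonempty J] →
    (j : J) → obj J →+ obj I →+ obj ({x : J // x ≠ j} ⊕ I)

attribute [instance] OperadData.grp

namespace OperadData

/-- `{x ∈ {*} | x ≠ *} ⊔ I = I`. -/
def unitLeftEquiv (I : Type) : I ≃ {x : Unit // x ≠ ()} ⊕ I where
  toFun := Sum.inr
  invFun
    | .inl x => absurd rfl x.2
    | .inr i => i
  left_inv _ := rfl
  right_inv
    | .inl x => absurd rfl x.2
    | .inr _ => rfl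

open Classical in
/-- `J = (J ∖ {j}) ⊔ {*}`, where `j` corresponds to `*`. -/
noncomputable def unitRightEquiv {J : Type} (j : J) : J ≃ {x : J // x ≠ j} ⊕ Unit where
  toFun x := if h : x = j then .inr () else .inl ⟨x, h⟩
  invFun
    | .inl x => x
    | .inr _ => j
  left_inv x := by by_cases h : x = j <;> simp [h]
  right_inv
    | .inl x => by simp [x.2]
    | .inr _ => by simp

/-- `(J ∖ {j}) ⊔ ((I ∖ {i}) ⊔ K) = (((J ∖ {j}) ⊔ I) ∖ {i}) ⊔ K`. -/
def seqEquiv {I J : Type} (K : Type) (j : J) (i : I) :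
    {x : J // x ≠ j} ⊕ ({y : I // y ≠ i} ⊕ K) ≃
      {z : {x : J // x ≠ j} ⊕ I // z ≠ .inr i} ⊕ K where
  toFun
    | .inl x => .inl ⟨.inl x, Sum.inl_ne_inr⟩
    | .inr (.inl y) => .inl ⟨.inr y, fun h => y.2 (Sum.inr_injective h)⟩
    | .inr (.inr k) => .inr k
  invFun
    | .inl ⟨.inl x, _⟩ => .inl x
    | .inl ⟨.inr y, h⟩ => .inr (.inl ⟨y, fun e => h (congrArg Sum.inr e)⟩)
    | .inr k => .inr (.inr k)
  left_inv
    | .inl _ => rfl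
    | .inr (.inl _) => rfl
    | .inr (.inr _) => rfl
  right_inv
    | .inl ⟨.inl _, _⟩ => rfl
    | .inl ⟨.inr _, _⟩ => rfl
    | .inr _ => rfl

/-- One direction of `parEquiv`. -/
def parFun {J : Type} (I K : Type) {j k : J} (h : k ≠ j) :
    {z : {x : J // x ≠ k} ⊕ K // z ≠ .inl ⟨j, h.symm⟩} ⊕ I →
      {z : {x : J // x ≠ j} ⊕ I // z ≠ .inl ⟨k, h⟩} ⊕ K
  | .inl ⟨.inl x, hx⟩ =>
      .inl ⟨.inl ⟨x.1, fun e => hx (congrArg Sum.inl (Subtype.ext e))⟩,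
        fun e => x.2 (congrArg Subtype.val (Sum.inl_injective e))⟩
  | .inl ⟨.inr c, _⟩ => .inr c
  | .inr i => .inl ⟨.inr i, Sum.inr_ne_inl⟩

/-- `(((J ∖ {k}) ⊔ K) ∖ {j}) ⊔ I = (((J ∖ {j}) ⊔ I) ∖ {k}) ⊔ K` for distinct `j, k ∈ J`. -/
def parEquiv {J : Type} (I K : Type) {j k : J} (h : k ≠ j) :
    {z : {x : J // x ≠ k} ⊕ K // z ≠ .inl ⟨j, h.symm⟩} ⊕ I ≃
      {z : {x : J // x ≠ j} ⊕ I // z ≠ .inl ⟨k, h⟩} ⊕ K where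
  toFun := parFun I K h
  invFun := parFun K I h.symm
  left_inv
    | .inl ⟨.inl _, _⟩ => rfl
    | .inl ⟨.inr _, _⟩ => rfl
    | .inr _ => rfl
  right_inv
    | .inl ⟨.inl _, _⟩ => rfl
    | .inl ⟨.inr _, _⟩ => rfl
    | .inr _ => rfl

/-- The axioms of a symmetric operad: functoriality of the relabelling, equivariance of the
partial compositions, the two unit axioms, and the sequential and parallel associativity axioms. -/
structure IsOperad (P : OperadData) : Prop where
  map_refl : ∀ {I : Type} [Finite I] [Nonempty I] (a : P.obj I), P.map (Equiv.refl I) a = a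
  map_trans : ∀ {I J K : Type} [Finite I] [Nonempty I] [Finite J] [Nonempty J]
    [Finite K] [Nonempty K] (σ : I ≃ J) (τ : J ≃ K) (a : P.obj I),
    P.map (σ.trans τ) a = P.map τ (P.map σ a)
  comp_map : ∀ {I I' J J' : Type} [Finite I] [Nonempty I] [Finite I'] [Nonempty I']
    [Finite J] [Nonempty J] [Finite J'] [Nonempty J'] (σ : J ≃ J') (τ : I ≃ I') (j : J)
    (a : P.obj J) (b : P.obj I),
    P.comp (σ j) (P.map σ a) (P.map τ b) =
      P.map (Equiv.sumCongr
        (σ.subtypeEquiv (p := fun x => x ≠ j) (q := fun x => x ≠ σ j)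
          fun _ => not_congr σ.injective.eq_iff.symm) τ) (P.comp j a b)
  unit_comp : ∀ {I : Type} [Finite I] [Nonempty I] (b : P.obj I),
    P.comp () P.unit b = P.map (unitLeftEquiv I) b
  comp_unit : ∀ {J : Type} [Finite J] [Nonempty J] (j : J) (a : P.obj J),
    P.comp j a P.unit = P.map (unitRightEquiv j) a
  comp_assoc : ∀ {I J K : Type} [Finite I] [Nonempty I] [Finite J] [Nonempty J]
    [Finite K] [Nonempty K] (j : J) (i : I) (a : P.obj J) (b : P.obj I) (c : P.obj K),
    P.comp (.inr i) (P.comp j a b) c = P.map (seqEquiv K j i) (P.comp j a (P.comp i b c))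
  comp_comm : ∀ {I J K : Type} [Finite I] [Nonempty I] [Finite J] [Nonempty J]
    [Finite K] [Nonempty K] {j k : J} (h : k ≠ j) (a : P.obj J) (b : P.obj I) (c : P.obj K),
    P.comp (.inl ⟨k, h⟩) (P.comp j a b) c =
      P.map (parEquiv I K h) (P.comp (.inl ⟨j, h.symm⟩) (P.comp k a c) b)

/-- Morphisms of operads. -/
@[ext]
structure Hom (P Q : OperadData) where
  app : (I : Type) → [Finite I] → [Nonempty I] → P.obj I →+ Q.obj I
  app_map : ∀ {I J : Type} [Finite I] [Nonempty I] [Finite J] [Nonempty J] (σ : I ≃ J)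
    (a : P.obj I), app J (P.map σ a) = Q.map σ (app I a)
  app_unit : app Unit P.unit = Q.unit
  app_comp : ∀ {I J : Type} [Finite I] [Nonempty I] [Finite J] [Nonempty J] (j : J)
    (a : P.obj J) (b : P.obj I),
    app ({x : J // x ≠ j} ⊕ I) (P.comp j a b) = Q.comp j (app J a) (app I b)

end OperadData

/-! ## Rooted trees -/

/-- A (non-planar) rooted tree with vertex set `I`, its edges being oriented towards the root:
`edge a b` means that `b` is the neighbour of `a` on the path from `a` to the root. Every vertex
has at most one outgoing edge, and there is a vertex without outgoing edge to which every vertex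
is joined by a directed path. -/
@[ext]
structure NonplanarTree (I : Type) where
  edge : I → I → Prop
  edge_unique : ∀ {a b c : I}, edge a b → edge a c → b = c
  exists_root : ∃ r, (∀ a, ¬ edge r a) ∧ ∀ a, Relation.ReflTransGen edge a r

namespace NonplanarTree

variable {I J : Type}

/-- `r` is the root. -/
def IsRoot (T : NonplanarTree I) (r : I) : Prop := ∀ a, ¬ T.edge r a

/-- `a` belongs to the subtree of all vertices lying above `b` (including `b` itself). -/
def Above (T : NonplanarTree I) (a b : I) : Prop := Relation.ReflTransGen T.edge a b

/-- The edges entering `j`, each one represented by its other end. -/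
def Entr (T : NonplanarTree I) (j : I) : Type := {x : I // T.edge x j}

instance [Finite I] (T : NonplanarTree I) (j : I) : Finite (T.Entr j) :=
  inferInstanceAs (Finite {x : I // T.edge x j})

instance [Finite I] : Finite (NonplanarTree I) :=
  Finite.of_injective (fun T : NonplanarTree I => T.edge) fun _ _ h => NonplanarTree.ext h

theorem eq_of_above_of_isRoot (T : NonplanarTree I) {a b : I} (h : T.Above a b) (ha : T.IsRoot a) :
    a = b := by
  rcases Relation.ReflTransGen.cases_head h with h | ⟨c, hc, _⟩
  · exact h
  · exact absurd hc (ha c)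

/-- There are no directed cycles. -/
theorem not_above_of_edge (T : NonplanarTree I) {a b : I} (h : T.edge a b) : ¬ T.Above b a := by
  obtain ⟨r, hr, hr'⟩ := T.exists_root
  have key : ∀ a, Relation.ReflTransGen T.edge a r → ∀ b, T.edge a b → ¬ T.Above b a := by
    intro a ha
    induction ha using Relation.ReflTransGen.head_induction_on with
    | refl => intro b hb; exact absurd hb (hr b)
    | head hac _ ih =>
      intro b hb hba
      cases T.edge_unique hac hb
      rcases Relation.ReflTransGen.cases_head hba with h | ⟨d, hd, hda⟩
      · subst h; exact ih _ hac Relation.ReflTransGen.refl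
      · exact ih d hd (hda.tail hac)
  exact key a (hr' a) b h

theorem ne_of_edge (T : NonplanarTree I) {a b : I} (h : T.edge a b) : a ≠ b := by
  rintro rfl
  exact T.not_above_of_edge h Relation.ReflTransGen.refl

/-- Of two vertices below a given vertex, one is below the other. -/
theorem above_total (T : NonplanarTree I) {a b c : I} (hb : T.Above a b) (hc : T.Above a c) :
    T.Above b c ∨ T.Above c b :=
  Relation.ReflTransGen.total_of_right_unique (fun _ _ _ h h' => T.edge_unique h h') hb hc

/-- Two distinct vertices with the same successor have disjoint subtrees. -/
theorem eq_of_above_siblings (T : NonplanarTree I) {a c d s : I} (hc : T.edge c s) (hd : T.edge d s)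
    (hac : T.Above a c) (had : T.Above a d) : c = d := by
  have key : ∀ {x y : I}, T.edge x s → T.edge y s → T.Above x y → x = y := by
    intro x y hx hy h
    rcases Relation.ReflTransGen.cases_head h with h | ⟨z, hz, hzy⟩
    · exact h
    · cases T.edge_unique hx hz
      exact absurd hzy (T.not_above_of_edge hy)
  rcases T.above_total hac had with h | h
  · exact key hc hd h
  · exact (key hd hc h).symm

/-- Relabelling. -/
def map (σ : I ≃ J) (T : NonplanarTree I) : NonplanarTree J where
  edge a b := T.edge (σ.symm a) (σ.symm b)
  edge_unique h h' := σ.symm.injective (T.edge_unique h h')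
  exists_root := by
    obtain ⟨r, hr, hr'⟩ := T.exists_root
    refine ⟨σ r, fun a h => hr _ (by simpa using h), fun a => ?_⟩
    have := Relation.ReflTransGen.lift (r := T.edge)
      (p := fun a b => T.edge (σ.symm a) (σ.symm b)) σ
      (fun x y h => by simpa [Function.onFun] using h) _ _ (hr' (σ.symm a))
    simpa [Function.onFun] using this

/-- The tree with a single vertex. -/
def point : NonplanarTree Unit where
  edge _ _ := False
  edge_unique h _ := h.elim
  exists_root := ⟨(), fun _ h => h, fun _ => Relation.ReflTransGen.refl⟩

/-- The edges of the tree obtained from `T` by substituting `S` for the vertex `j`, the edges of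
`T` that enter `j` being attached to vertices of `S` as prescribed by `f`. The edge of `T` that
leaves `j` (if there is one) now leaves the root of `S`. -/
def insertEdge (T : NonplanarTree J) (j : J) (S : NonplanarTree I) (f : T.Entr j → I) :
    {x : J // x ≠ j} ⊕ I → {x : J // x ≠ j} ⊕ I → Prop
  | .inl x, .inl y => T.edge x y
  | .inl x, .inr s => ∃ h : T.edge x j, f ⟨x, h⟩ = s
  | .inr s, .inl y => S.IsRoot s ∧ T.edge j y
  | .inr s, .inr t => S.edge s t

/-- The tree obtained from `T` by substituting `S` for the vertex `j` along `f`. -/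
def insert (T : NonplanarTree J) (j : J) (S : NonplanarTree I) (f : T.Entr j → I) :
    NonplanarTree ({x : J // x ≠ j} ⊕ I) where
  edge := insertEdge T j S f
  edge_unique := by
    rintro (x | s) (y | t) (z | u) h h'
    · exact congrArg Sum.inl (Subtype.ext (T.edge_unique h h'))
    · obtain ⟨h', _⟩ := h'; exact absurd (T.edge_unique h h') y.2
    · obtain ⟨h, _⟩ := h; exact absurd (T.edge_unique h' h) z.2
    · obtain ⟨_, rfl⟩ := h; obtain ⟨_, rfl⟩ := h'; rfl
    · exact congrArg Sum.inl (Subtype.ext (T.edge_unique h.2 h'.2))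
    · exact absurd h' (h.1 _)
    · exact absurd h (h'.1 _)
    · exact congrArg Sum.inr (S.edge_unique h h')
  exists_root := by
    obtain ⟨r, hr, hr'⟩ := T.exists_root
    obtain ⟨q, hq, hq'⟩ := S.exists_root
    have inS : ∀ s, Relation.ReflTransGen (insertEdge T j S f) (.inr s) (.inr q) := fun s =>
      Relation.ReflTransGen.lift (r := S.edge) (p := insertEdge T j S f) Sum.inr
        (fun _ _ h => h) _ _ (hq' s)
    by_cases hj : r = j
    · subst hj
      refine ⟨.inr q, ?_, ?_⟩
      · rintro (x | s) h
        · exact hr _ h.2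
        · exact hq _ h
      · rintro (⟨x, hx⟩ | s)
        · have key : ∀ x, Relation.ReflTransGen T.edge x r → ∀ hx : x ≠ r,
              Relation.ReflTransGen (insertEdge T r S f) (.inl ⟨x, hx⟩) (.inr q) := by
            intro x h
            induction h using Relation.ReflTransGen.head_induction_on with
            | refl => intro hx; exact absurd rfl hx
            | @head a c hac _ ih =>
              intro hx
              by_cases hc : c = r
              · subst hc
                exact Relation.ReflTransGen.head (show insertEdge T c S f (.inl ⟨a, hx⟩)
                  (.inr (f ⟨a, hac⟩)) from ⟨hac, rfl⟩) (inS _)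
              · exact Relation.ReflTransGen.head (show insertEdge T r S f (.inl ⟨a, hx⟩)
                  (.inl ⟨c, hc⟩) from hac) (ih hc)
          exact key x (hr' x) hx
        · exact inS s
    · refine ⟨.inl ⟨r, hj⟩, ?_, ?_⟩
      · rintro (x | s) h
        · exact hr _ h
        · exact hr _ h.1
      · have key : ∀ x, Relation.ReflTransGen T.edge x r →
            (∀ hx : x ≠ j, Relation.ReflTransGen (insertEdge T j S f) (.inl ⟨x, hx⟩)
              (.inl ⟨r, hj⟩)) ∧
            (x = j → ∀ s, Relation.ReflTransGen (insertEdge T j S f) (.inr s)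
              (.inl ⟨r, hj⟩)) := by
          intro x h
          induction h using Relation.ReflTransGen.head_induction_on with
          | refl => exact ⟨fun _ => Relation.ReflTransGen.refl, fun h => absurd h hj⟩
          | @head a c hac _ ih =>
            refine ⟨fun hx => ?_, fun hx s => ?_⟩
            · by_cases hc : c = j
              · subst hc
                exact Relation.ReflTransGen.head (show insertEdge T c S f (.inl ⟨a, hx⟩)
                  (.inr (f ⟨a, hac⟩)) from ⟨hac, rfl⟩) (ih.2 rfl _)
              · exact Relation.ReflTransGen.head (show insertEdge T j S f (.inl ⟨a, hx⟩)
                  (.inl ⟨c, hc⟩) from hac) (ih.1 hc)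
            · subst hx
              have hc : c ≠ a := (T.ne_of_edge hac).symm
              exact (inS s).trans
                (Relation.ReflTransGen.head (show insertEdge T a S f (.inr q)
                  (.inl ⟨c, hc⟩) from ⟨hq, hac⟩) (ih.1 hc))
        rintro (⟨x, hx⟩ | s)
        · exact (key x (hr' x)).1 hx
        · exact (key j (hr' j)).2 rfl s

/-- The tree on `{0, 1}` with root `0`. -/
def edge01 : NonplanarTree (Fin 2) where
  edge a b := a = 1 ∧ b = 0
  edge_unique h h' := h.2.trans h'.2.symm
  exists_root := by
    refine ⟨0, fun a h => absurd h.1 (by decide), fun a => ?_⟩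
    fin_cases a
    · exact Relation.ReflTransGen.refl
    · exact Relation.ReflTransGen.single ⟨rfl, rfl⟩

end NonplanarTree

/-- The operad `PreLie`, on the free modules over rooted trees:
`T ∘_j S` is the sum of the substitutions of `S` for the vertex `j` of `T`, over all maps from the
set of edges of `T` that enter `j` to the set of vertices of `S`. -/
noncomputable def PreLie : OperadData where
  obj I _ _ := FreeAbelianGroup (NonplanarTree I)
  map σ := FreeAbelianGroup.map (NonplanarTree.map σ)
  unit := FreeAbelianGroup.of NonplanarTree.point
  comp {I _} _ _ _ _ j := FreeAbelianGroup.lift fun T => FreeAbelianGroup.lift fun S =>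
    letI := Fintype.ofFinite (T.Entr j → I)
    ∑ f : T.Entr j → I, FreeAbelianGroup.of (NonplanarTree.insert T j S f)

/-! ## Planar rooted trees -/

/-- A planar rooted tree with vertex set `I`: a rooted tree together with, for every vertex `s`, a
strict total order (from left to right) on the set of edges that enter `s`. Here `left a b` means
that `a` and `b` have the same successor and that the edge leaving `a` is on the left of the edge
leaving `b`. -/
@[ext]
structure PlanarTree (I : Type) extends NonplanarTree I where
  left : I → I → Prop
  siblings_of_left : ∀ {a b : I}, left a b → ∃ s, edge a s ∧ edge b s
  left_irrefl : ∀ a : I, ¬ left a a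
  left_trans : ∀ {a b c : I}, left a b → left b c → left a c
  left_total : ∀ {a b s : I}, edge a s → edge b s → a ≠ b → left a b ∨ left b a

namespace PlanarTree

variable {I J : Type}

instance [Finite I] : Finite (PlanarTree I) :=
  Finite.of_injective (fun T : PlanarTree I => (T.edge, T.left)) fun _ _ h =>
    PlanarTree.ext (congrArg Prod.fst h) (congrArg Prod.snd h)

/-- An angle of a planar tree: a vertex and a gap in the totally ordered set of the edges entering
this vertex, i.e. a cut of that set into a left part `lower` and a right part (either of which may
be empty). A vertex with `k` entering edges has `k + 1` angles. -/
@[ext]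
structure Angle (S : PlanarTree I) where
  vertex : I
  lower : Set I
  edge_of_mem : ∀ {c}, c ∈ lower → S.edge c vertex
  mem_of_left : ∀ {c d}, c ∈ lower → S.left d c → d ∈ lower

instance [Finite I] (S : PlanarTree I) : Finite (Angle S) :=
  Finite.of_injective (fun a : Angle S => (a.vertex, a.lower)) fun _ _ h =>
    Angle.ext (congrArg Prod.fst h) (congrArg Prod.snd h)

/-- The order of the angles from left to right, for the tree drawn with its root at the bottom and
a path drawn upwards out of every angle. The four cases: the angles are at the same vertex; the
second one is in the subtree of some `c` directly above the vertex of the first one, and `c` is on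
the right of the first angle; the first one is in the subtree of some `c` directly above the vertex
of the second one, and `c` is on the left of the second angle; the angles are in the subtrees of
`c` and `d`, where `c` is on the left of `d`. -/
instance (S : PlanarTree I) : LE (Angle S) where
  le a b :=
    (a.vertex = b.vertex ∧ a.lower ⊆ b.lower) ∨
    (∃ c, S.edge c a.vertex ∧ c ∉ a.lower ∧ S.Above b.vertex c) ∨
    (∃ c, S.edge c b.vertex ∧ c ∈ b.lower ∧ S.Above a.vertex c) ∨
    (∃ c d, S.left c d ∧ S.Above a.vertex c ∧ S.Above b.vertex d)

theorem Angle.lower_subset_of_le {S : PlanarTree I} {a b : Angle S} (h : a ≤ b)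
    (hv : a.vertex = b.vertex) : a.lower ⊆ b.lower := by
  rcases h with h | ⟨c, hc, _, h⟩ | ⟨c, hc, _, h⟩ | ⟨c, d, hcd, hc, hd⟩
  · exact h.2
  · exact absurd (hv ▸ h) (S.not_above_of_edge hc)
  · exact absurd (hv ▸ h) (S.not_above_of_edge hc)
  · obtain ⟨s, hs, hs'⟩ := S.siblings_of_left hcd
    rw [hv] at hc
    cases S.eq_of_above_siblings hs hs' hc hd
    exact absurd hcd (S.left_irrefl _)

/-- Relabelling. -/
def map (σ : I ≃ J) (T : PlanarTree I) : PlanarTree J where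
  toNonplanarTree := T.toNonplanarTree.map σ
  left a b := T.left (σ.symm a) (σ.symm b)
  siblings_of_left h := by
    obtain ⟨s, hs, hs'⟩ := T.siblings_of_left h
    exact ⟨σ s, by simpa [NonplanarTree.map] using hs, by simpa [NonplanarTree.map] using hs'⟩
  left_irrefl a := T.left_irrefl _
  left_trans h h' := T.left_trans h h'
  left_total h h' hne := T.left_total h h' fun e => hne (σ.symm.injective e)

/-- The tree with a single vertex. -/
def point : PlanarTree Unit where
  toNonplanarTree := NonplanarTree.point
  left _ _ := False
  siblings_of_left h := h.elim
  left_irrefl _ h := h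
  left_trans h _ := h
  left_total h _ _ := h.elim

/-- The weakly increasing maps from the set of edges of `T` that enter `j`, ordered from left to
right, to the set of angles of `S`. -/
def Attaching (T : PlanarTree J) (j : J) (S : PlanarTree I) : Type :=
  {f : T.Entr j → Angle S // ∀ x y : T.Entr j, T.left x.1 y.1 → f x ≤ f y}

instance [Finite I] [Finite J] (T : PlanarTree J) (j : J) (S : PlanarTree I) :
    Finite (Attaching T j S) :=
  inferInstanceAs (Finite {_f : T.Entr j → Angle S // _})

/-- The left-to-right order of siblings in the tree obtained from `T` by substituting `S` for the
vertex `j`, the edges of `T` entering `j` being drawn into the angles of `S` prescribed by `f`.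
Edges attached in the same angle keep their order; an edge attached in an angle is on the right of
the edges of `S` in the left part of this angle and on the left of the other ones at the same
vertex; the root of `S` takes the place of `j` among the siblings of `j`. -/
def insertLeft (T : PlanarTree J) (j : J) (S : PlanarTree I) (f : T.Entr j → Angle S) :
    {x : J // x ≠ j} ⊕ I → {x : J // x ≠ j} ⊕ I → Prop
  | .inl x, .inl y => T.left x y ∧
      ∀ (hx : T.edge x j) (hy : T.edge y j), (f ⟨x, hx⟩).vertex = (f ⟨y, hy⟩).vertex
  | .inl x, .inr s =>
      (∃ h : T.edge x j, S.edge s (f ⟨x, h⟩).vertex ∧ s ∉ (f ⟨x, h⟩).lower) ∨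
      (T.left x j ∧ S.IsRoot s)
  | .inr s, .inl y =>
      (∃ h : T.edge y j, s ∈ (f ⟨y, h⟩).lower) ∨
      (T.left j y ∧ S.IsRoot s)
  | .inr s, .inr t => S.left s t


/-- The planar tree obtained from `T` by substituting `S` for the vertex `j` along `f`. -/
def insert (T : PlanarTree J) (j : J) (S : PlanarTree I) (f : Attaching T j S) :
    PlanarTree ({x : J // x ≠ j} ⊕ I) where
  toNonplanarTree := T.toNonplanarTree.insert j S.toNonplanarTree fun x => (f.1 x).vertex
  left := insertLeft T j S f.1
  siblings_of_left := by
    rintro (x | s) (y | t) h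
    · obtain ⟨h, hv⟩ := h
      obtain ⟨s, hs, hs'⟩ := T.siblings_of_left h
      by_cases e : s = j
      · subst e
        exact ⟨.inr (f.1 ⟨x, hs⟩).vertex, ⟨hs, rfl⟩, ⟨hs', (hv hs hs').symm⟩⟩
      · exact ⟨.inl ⟨s, e⟩, hs, hs'⟩
    · rcases h with ⟨h, ht, _⟩ | ⟨h, ht⟩
      · exact ⟨.inr (f.1 ⟨x, h⟩).vertex, ⟨h, rfl⟩, ht⟩
      · obtain ⟨u, hu, hu'⟩ := T.siblings_of_left h
        exact ⟨.inl ⟨u, (T.ne_of_edge hu').symm⟩, hu, ⟨ht, hu'⟩⟩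
    · rcases h with ⟨h, hs⟩ | ⟨h, hs⟩
      · exact ⟨.inr (f.1 ⟨y, h⟩).vertex, (f.1 ⟨y, h⟩).edge_of_mem hs, ⟨h, rfl⟩⟩
      · obtain ⟨u, hu, hu'⟩ := T.siblings_of_left h
        exact ⟨.inl ⟨u, (T.ne_of_edge hu).symm⟩, ⟨hs, hu⟩, hu'⟩
    · obtain ⟨u, hu, hu'⟩ := S.siblings_of_left h
      exact ⟨.inr u, hu, hu'⟩
  left_irrefl := by
    rintro (x | s)
    · exact fun h => T.left_irrefl _ h.1
    · exact S.left_irrefl s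
  left_trans := by
    have notRoot : ∀ {s t}, S.left s t → ¬ S.IsRoot s ∧ ¬ S.IsRoot t := by
      intro s t h
      obtain ⟨u, hu, hu'⟩ := S.siblings_of_left h
      exact ⟨fun h => h _ hu, fun h => h _ hu'⟩
    have notEntr : ∀ {x}, (T.left x j ∨ T.left j x) → ¬ T.edge x j := by
      rintro x (h | h) hx
      · obtain ⟨u, hu, hu'⟩ := T.siblings_of_left h
        exact T.ne_of_edge hu' (T.edge_unique hx hu)
      · obtain ⟨u, hu, hu'⟩ := T.siblings_of_left h
        exact T.ne_of_edge hu (T.edge_unique hx hu')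
    rintro (x | s) (y | t) (z | u) h h'
    · refine ⟨T.left_trans h.1 h'.1, fun hx hz => ?_⟩
      obtain ⟨v, hv, hv'⟩ := T.siblings_of_left h.1
      cases T.edge_unique hx hv
      exact (h.2 hv hv').trans (h'.2 hv' hz)
    · obtain ⟨v, hv, hv'⟩ := T.siblings_of_left h.1
      rcases h' with ⟨hy, hu, hu'⟩ | ⟨hy, hu⟩
      · cases T.edge_unique hy hv'
        have e := h.2 hv hv'
        exact .inl ⟨hv, e ▸ hu, fun hm => hu' (Angle.lower_subset_of_le
          (f.2 ⟨x, hv⟩ ⟨y, hv'⟩ h.1) e hm)⟩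
      · exact .inr ⟨T.left_trans h.1 hy, hu⟩
    · rcases h with ⟨hx, ht, ht'⟩ | ⟨hx, ht⟩ <;> rcases h' with ⟨hz, hm⟩ | ⟨hz, hm⟩
      · have e : (f.1 ⟨x, hx⟩).vertex = (f.1 ⟨z, hz⟩).vertex :=
          S.edge_unique ht ((f.1 ⟨z, hz⟩).edge_of_mem hm)
        refine ⟨?_, fun _ _ => e⟩
        have hne : x.1 ≠ z.1 := by
          intro hxz
          have : x = z := Subtype.ext hxz
          subst this
          exact ht' hm
        rcases T.left_total hx hz hne with hl | hl
        · exact hl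
        · exact absurd (Angle.lower_subset_of_le (f.2 ⟨z, hz⟩ ⟨x, hx⟩ hl) e.symm hm) ht'
      · exact absurd ht (hm _)
      · exact absurd ((f.1 ⟨z, hz⟩).edge_of_mem hm) (ht _)
      · exact ⟨T.left_trans hx hz, fun h _ => absurd h (notEntr (.inl hx))⟩
    · rcases h with ⟨hx, ht, ht'⟩ | ⟨_, ht⟩
      · obtain ⟨v, hv, hv'⟩ := S.siblings_of_left h'
        cases S.edge_unique ht hv
        exact .inl ⟨hx, hv', fun hm => ht' ((f.1 ⟨x, hx⟩).mem_of_left hm h')⟩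
      · exact absurd ht (notRoot h').1
    · obtain ⟨v, hv, hv'⟩ := T.siblings_of_left h'.1
      rcases h with ⟨hy, hm⟩ | ⟨hy, hs⟩
      · cases T.edge_unique hy hv
        exact .inl ⟨hv', Angle.lower_subset_of_le (f.2 ⟨y, hv⟩ ⟨z, hv'⟩ h'.1) (h'.2 hv hv') hm⟩
      · exact .inr ⟨T.left_trans hy h'.1, hs⟩
    · rcases h with ⟨hy, hm⟩ | ⟨hy, hs⟩ <;> rcases h' with ⟨hy', hu, hu'⟩ | ⟨hy', hu⟩
      · have hs := (f.1 ⟨y, hy⟩).edge_of_mem hm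
        have hne : s ≠ u := by rintro rfl; exact hu' hm
        rcases S.left_total hs hu hne with hl | hl
        · exact hl
        · exact absurd ((f.1 ⟨y, hy⟩).mem_of_left hm hl) hu'
      · exact absurd hy (notEntr (.inl hy'))
      · exact absurd hy' (notEntr (.inr hy))
      · exact absurd (T.left_trans hy hy') (T.left_irrefl _)
    · rcases h' with ⟨hz, hm⟩ | ⟨_, ht⟩
      · exact .inl ⟨hz, (f.1 ⟨z, hz⟩).mem_of_left hm h⟩
      · exact absurd ht (notRoot h).2
    · exact S.left_trans h h'
  left_total := by
    rintro (x | s) (y | t) (v | v) h h' hne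
    · rcases T.left_total h h' fun e => hne (congrArg Sum.inl (Subtype.ext e)) with hl | hl
      · exact .inl ⟨hl, fun hx _ => absurd (T.edge_unique h hx) v.2⟩
      · exact .inr ⟨hl, fun hx _ => absurd (T.edge_unique h' hx) v.2⟩
    · obtain ⟨hx, rfl⟩ := h
      obtain ⟨hy, e⟩ := h'
      rcases T.left_total hx hy fun e => hne (congrArg Sum.inl (Subtype.ext e)) with hl | hl
      · exact .inl ⟨hl, fun _ _ => e.symm⟩
      · exact .inr ⟨hl, fun _ _ => e⟩
    · rcases T.left_total h h'.2 x.2 with hl | hl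
      · exact .inl (.inr ⟨hl, h'.1⟩)
      · exact .inr (.inr ⟨hl, h'.1⟩)
    · obtain ⟨hx, rfl⟩ := h
      by_cases hm : t ∈ (f.1 ⟨x, hx⟩).lower
      · exact .inr (.inl ⟨hx, hm⟩)
      · exact .inl (.inl ⟨hx, h', hm⟩)
    · rcases T.left_total h.2 h' (Ne.symm y.2) with hl | hl
      · exact .inl (.inr ⟨hl, h.1⟩)
      · exact .inr (.inr ⟨hl, h.1⟩)
    · obtain ⟨hy, rfl⟩ := h'
      by_cases hm : s ∈ (f.1 ⟨y, hy⟩).lower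
      · exact .inl (.inl ⟨hy, hm⟩)
      · exact .inr (.inl ⟨hy, h, hm⟩)
    · have root_unique : s = t := by
        obtain ⟨r, _, hr'⟩ := S.exists_root
        rw [S.eq_of_above_of_isRoot (hr' s) h.1, S.eq_of_above_of_isRoot (hr' t) h'.1]
      exact absurd (congrArg Sum.inr root_unique) hne
    · exact S.left_total h h' fun e => hne (congrArg Sum.inr e)

/-- The corolla on `{0, 1}` with root `0` and with a single leaf `1`. -/
def corolla01 : PlanarTree (Fin 2) where
  toNonplanarTree := NonplanarTree.edge01
  left _ _ := False
  siblings_of_left h := h.elim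
  left_irrefl _ h := h
  left_trans h _ := h
  left_total h h' hne := hne (h.1.trans h'.1.symm) |>.elim

end PlanarTree

/-- The operad `Brace`, on the free modules over planar rooted trees: `T ∘_j S` is the sum of the
substitutions of `S` for the vertex `j` of `T`, over all weakly increasing maps from the set of
edges of `T` that enter `j` to the set of angles of `S`. -/
noncomputable def Brace : OperadData where
  obj I _ _ := FreeAbelianGroup (PlanarTree I)
  map σ := FreeAbelianGroup.map (PlanarTree.map σ)
  unit := FreeAbelianGroup.of PlanarTree.point
  comp {_ _} _ _ _ _ j := FreeAbelianGroup.lift fun T => FreeAbelianGroup.lift fun S =>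
    letI := Fintype.ofFinite (T.Attaching j S)
    ∑ f : T.Attaching j S, FreeAbelianGroup.of (PlanarTree.insert T j S f)

/-- The operation `x₁ ∘ x₂` of `PreLie`. -/
noncomputable def preLieProduct : PreLie.obj (Fin 2) :=
  FreeAbelianGroup.of NonplanarTree.edge01

/-- The operation `{x₁ | x₂}` of `Brace`. -/
noncomputable def braceProduct : Brace.obj (Fin 2) :=
  FreeAbelianGroup.of PlanarTree.corolla01

/-- The sum of all planar rooted trees on `I` whose underlying non-planar rooted tree is `T`. -/
noncomputable def symmetrization {I : Type} [Finite I] [Nonempty I] (T : NonplanarTree I) :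
    Brace.obj I :=
  letI := Fintype.ofFinite {P : PlanarTree I // P.toNonplanarTree = T}
  ∑ P : {P : PlanarTree I // P.toNonplanarTree = T}, (FreeAbelianGroup.of P.1 : Brace.obj I)

/-! ## Rooted trees as orders -/

namespace NonplanarTree

variable {I J : Type}

/-! A rooted tree is encoded by the order `Above`, a planar one by `Above` together with the
relation `LeftOf`: two distinct vertices are either comparable, or one lies to the left of the
other. Both relations determine the tree (`ext_above`, `ext_rel`), and both restrict to any finite
subset with a smallest element (`exists_restrict`).

Substitution is then described without the map `f`. A tree `X` on `(J ∖ {j}) ⊔ I` is one of the `T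
∘_j^f S` exactly when `X` restricts to `S` on `I`, restricts to `T` on `J` once `j` is represented
by the root of `S`, and everything in `S` has the same vertices of `T` below it. This is
`IsInsertion`. It leaves open where in `S` the branches entering `j` are attached, and that is the
freedom in `f`. Since `f` can be read off from `X`, the composition `T ∘_j S` is the
multiplicity-free sum of all `X` with `IsInsertion T j S X` (`range_insert`, `insert_injective`).
Since `T` and `S` can be read off from `X` as well (`IsInsertion.unique`), composing two sums over
sets again gives a sum over a set (`map₂_setSum`).

The operad axioms for `Brace` thus become equivalences between conditions on one tree `X`; the
intermediate trees in the associativity axioms are restrictions of `X`. Symmetrization replaces a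
set of rooted trees by its preimage under forgetting planarity. It respects composition because a
planar `X` over an insertion of `S` into `T` induces planar structures on `T` and `S`. It is
injective, so `PreLie` inherits the axioms from `Brace`.

Uniqueness holds because the product generates `PreLie`. If `A` is a branch at the root of `T` and
`B` is the rest, then substituting `B` and `A` into the product gives the sum of all graftings of
`A` on vertices of `B`. One of them is `T`; every other one has strictly more pairs in relation
`Above`. Induction on the number of vertices, and then on the number of pairs not in relation,
determines a morphism on all trees. -/

theorem above_refl (T : NonplanarTree I) (a : I) : T.Above a a := Relation.ReflTransGen.refl

theorem above_of_edge (T : NonplanarTree I) {a b : I} (h : T.edge a b) : T.Above a b :=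
  Relation.ReflTransGen.single h

theorem above_trans (T : NonplanarTree I) {a b c : I} (h : T.Above a b) (h' : T.Above b c) :
    T.Above a c :=
  Relation.ReflTransGen.trans h h'

theorem above_of_edge_of_ne (T : NonplanarTree I) {a b c : I} (h : T.edge a b) (h' : T.Above a c)
    (hne : c ≠ a) : T.Above b c := by
  rcases Relation.ReflTransGen.cases_head h' with e | ⟨d, hd, hdc⟩
  · exact absurd e.symm hne
  · exact T.edge_unique h hd ▸ hdc

theorem above_antisymm (T : NonplanarTree I) {a b : I} (h : T.Above a b) (h' : T.Above b a) :
    a = b := by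
  rcases Relation.ReflTransGen.cases_head h with e | ⟨d, hd, hdb⟩
  · exact e
  · exact absurd (T.above_trans hdb h') (T.not_above_of_edge hd)

theorem exists_forall_above (T : NonplanarTree I) : ∃ r, ∀ a, T.Above a r :=
  let ⟨r, _, h⟩ := T.exists_root
  ⟨r, h⟩

theorem isRoot_iff (T : NonplanarTree I) {r : I} : T.IsRoot r ↔ ∀ a, T.Above a r := by
  constructor
  · intro h a
    obtain ⟨q, hq⟩ := T.exists_forall_above
    exact T.eq_of_above_of_isRoot (hq r) h ▸ hq a
  · exact fun h a ha => T.not_above_of_edge ha (h a)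

theorem root_unique (T : NonplanarTree I) {r q : I} (hr : ∀ a, T.Above a r)
    (hq : ∀ a, T.Above a q) : r = q :=
  T.above_antisymm (hq r) (hr q)

/-- Edges are the covering pairs of `Above`: the successor of `a` is the nearest vertex strictly
below it. Hence the order alone recovers the tree. -/
theorem edge_iff (T : NonplanarTree I) {a b : I} :
    T.edge a b ↔ T.Above a b ∧ a ≠ b ∧ ∀ c, T.Above a c → c ≠ a → T.Above b c := by
  constructor
  · exact fun h => ⟨T.above_of_edge h, T.ne_of_edge h, fun c hc hne =>
      T.above_of_edge_of_ne h hc hne⟩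
  · rintro ⟨h, hne, H⟩
    rcases Relation.ReflTransGen.cases_head h with e | ⟨d, hd, hdb⟩
    · exact absurd e hne
    · rwa [T.above_antisymm (H d (T.above_of_edge hd) (T.ne_of_edge hd).symm) hdb]

theorem ext_above {T S : NonplanarTree I} (h : ∀ a b, T.Above a b ↔ S.Above a b) : T = S := by
  ext a b
  rw [edge_iff, edge_iff]
  simp only [h]

/-- A rooted tree is determined by a part of its edges that forms a rooted tree. -/
theorem eq_of_edge_imp {T S : NonplanarTree I} (h : ∀ a b, T.edge a b → S.edge a b) : T = S := by
  ext a b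
  refine ⟨h a b, fun hab => ?_⟩
  obtain ⟨r, hr⟩ := T.exists_forall_above
  rcases Relation.ReflTransGen.cases_head (hr a) with e | ⟨d, hd, _⟩
  -- Here `a` is the root of `T`, so `b` is above `a` in `T` and therefore in `S`; an edge of `S`
  -- from `a` to `b` would close a cycle.
  · subst e
    exact absurd (Relation.ReflTransGen.mono h _ _ (hr b)) (S.not_above_of_edge hab)
  · exact S.edge_unique (h _ _ hd) hab ▸ hd

theorem above_map (T : NonplanarTree I) (σ : I ≃ J) (a b : J) :
    (T.map σ).Above a b ↔ T.Above (σ.symm a) (σ.symm b) := by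
  constructor
  · exact fun h => Relation.ReflTransGen.lift (r := (T.map σ).edge) (p := T.edge) σ.symm
      (fun _ _ h => h) _ _ h
  · intro h
    have := Relation.ReflTransGen.lift (r := T.edge) (p := (T.map σ).edge) σ
      (fun x y h => by simpa [map, Function.onFun] using h) _ _ h
    simpa [Function.onFun, Above] using this

theorem map_map {K : Type} (T : NonplanarTree I) (σ : I ≃ J) (τ : J ≃ K) :
    (T.map σ).map τ = T.map (σ.trans τ) := rfl

theorem map_refl (T : NonplanarTree I) : T.map (Equiv.refl I) = T := rfl

/-- The covering relation `E` is the edge relation. Totality of the set of vertices below a given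
one makes the cover unique, and finiteness makes it exist and makes its chains reach every vertex
below. -/
theorem exists_tree_above [Finite I] (V : I → I → Prop) (refl : ∀ a, V a a)
    (trans : ∀ {a b c}, V a b → V b c → V a c) (antisymm : ∀ {a b}, V a b → V b a → a = b)
    (total : ∀ {a b c}, V a b → V a c → V b c ∨ V c b) (root : ∃ r, ∀ a, V a r) :
    ∃ T : NonplanarTree I, ∀ a b, T.Above a b ↔ V a b := by
  classical
  let E : I → I → Prop := fun a b => V a b ∧ a ≠ b ∧ ∀ c, V a c → c ≠ a → V b c
  obtain ⟨r, hr⟩ := root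
  have step : ∀ a, a ≠ r → ∃ b, E a b := by
    intro a ha
    let P : Set I := {b | V a b ∧ b ≠ a}
    -- Among the vertices strictly below `a`, the nearest one has the most vertices below it.
    obtain ⟨b, hb, hmin⟩ := Set.exists_max_image P (fun b => {c | V b c}.ncard) P.toFinite
      ⟨r, hr a, ha.symm⟩
    refine ⟨b, hb.1, hb.2.symm, fun c hc hca => ?_⟩
    rcases total hb.1 hc with h | h
    · exact h
    · have hsub : {x | V b x} ⊆ {x | V c x} := fun x hx => trans h hx
      have := Set.eq_of_subset_of_ncard_le hsub (hmin c ⟨hc, hca⟩) (Set.toFinite _)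
      have hc : c ∈ {x | V b x} := this ▸ refl c
      exact hc
  have toV : ∀ {a b}, Relation.ReflTransGen E a b → V a b := by
    intro a b h
    induction h with
    | refl => exact refl a
    | tail _ h ih => exact trans ih h.1
  -- Passing to the cover of `a` lowers the number of vertices below, which is the parameter of the
  -- induction.
  have ofV : ∀ n a b, {c | V a c}.ncard = n → V a b → Relation.ReflTransGen E a b := by
    intro n
    induction n using Nat.strong_induction_on with
    | _ n ih =>
      intro a b hn h
      by_cases hab : b = a
      · exact hab ▸ Relation.ReflTransGen.refl
      · have har : a ≠ r := by
          rintro rfl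
          exact hab (antisymm (hr b) h)
        obtain ⟨c, hc⟩ := step a har
        refine Relation.ReflTransGen.head hc (ih _ ?_ c b rfl (hc.2.2 b h hab))
        rw [← hn]
        refine Set.ncard_lt_ncard ⟨fun x hx => trans hc.1 hx, fun hsub => ?_⟩ (Set.toFinite _)
        exact hc.2.1 (antisymm hc.1 (hsub (refl a)))
  refine ⟨⟨E, fun {a b c} hb hc => ?_, r, fun a h => h.2.1 (antisymm h.1 (hr a)),
    fun a => ofV _ a r rfl (hr a)⟩, fun a b => ⟨toV, ofV _ a b rfl⟩⟩
  exact antisymm (hb.2.2 c hc.1 hc.2.1.symm) (hc.2.2 b hb.1 hb.2.1.symm)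

/-- The order of a rooted tree, restricted to a subset with a smallest element, is the order of a
rooted tree. -/
theorem exists_restrict [Finite I] (X : NonplanarTree J) {ι : I → J} (hι : ι.Injective) (r : I)
    (hr : ∀ a, X.Above (ι a) (ι r)) :
    ∃ T : NonplanarTree I, ∀ a b, T.Above a b ↔ X.Above (ι a) (ι b) :=
  exists_tree_above (fun a b => X.Above (ι a) (ι b)) (fun _ => X.above_refl _)
    X.above_trans (fun h h' => hι (X.above_antisymm h h')) X.above_total ⟨r, hr⟩

end NonplanarTree

/-! ### The left-to-right order of a planar tree -/

namespace PlanarTree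

variable {I J : Type}

/-- `a` is on the left of `b`: neither is above the other one, and the branch containing `a` is
on the left of the branch containing `b`. -/
def LeftOf (T : PlanarTree I) (a b : I) : Prop :=
  ∃ c d, T.left c d ∧ T.Above a c ∧ T.Above b d

theorem leftOf_of_left (T : PlanarTree I) {a b : I} (h : T.left a b) : T.LeftOf a b :=
  ⟨a, b, h, T.above_refl a, T.above_refl b⟩

theorem LeftOf.mono {T : PlanarTree I} {a b a' b' : I} (h : T.LeftOf a b) (ha : T.Above a' a)
    (hb : T.Above b' b) : T.LeftOf a' b' :=
  let ⟨c, d, h, hc, hd⟩ := h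
  ⟨c, d, h, T.above_trans ha hc, T.above_trans hb hd⟩

theorem false_of_left_of_above (T : PlanarTree I) {a c d : I} (h : T.left c d) (hc : T.Above a c)
    (hd : T.Above a d) : False := by
  obtain ⟨s, hs, hs'⟩ := T.siblings_of_left h
  cases T.eq_of_above_siblings hs hs' hc hd
  exact T.left_irrefl _ h

theorem LeftOf.not_above {T : PlanarTree I} {a b : I} (h : T.LeftOf a b) : ¬ T.Above a b :=
  let ⟨_, _, h, hc, hd⟩ := h
  fun hab => T.false_of_left_of_above h hc (T.above_trans hab hd)

theorem LeftOf.not_above' {T : PlanarTree I} {a b : I} (h : T.LeftOf a b) : ¬ T.Above b a :=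
  let ⟨_, _, h, hc, hd⟩ := h
  fun hba => T.false_of_left_of_above h (T.above_trans hba hc) hd

theorem leftOf_irrefl (T : PlanarTree I) (a : I) : ¬ T.LeftOf a a :=
  fun h => h.not_above (T.above_refl a)

/-- The branches `d₁` and `c₂` both lie below `b`, hence are comparable. If they differ, the
branching nearer to the root also separates `a` from `c`. -/
theorem leftOf_trans (T : PlanarTree I) {a b c : I} (h : T.LeftOf a b) (h' : T.LeftOf b c) :
    T.LeftOf a c := by
  obtain ⟨c₁, d₁, h₁, hc₁, hd₁⟩ := h
  obtain ⟨c₂, d₂, h₂, hc₂, hd₂⟩ := h'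
  by_cases e : d₁ = c₂
  · subst e
    exact ⟨c₁, d₂, T.left_trans h₁ h₂, hc₁, hd₂⟩
  obtain ⟨s₁, hs₁, hs₁'⟩ := T.siblings_of_left h₁
  obtain ⟨s₂, hs₂, hs₂'⟩ := T.siblings_of_left h₂
  rcases T.above_total hd₁ hc₂ with h | h
  · exact ⟨c₂, d₂, h₂, T.above_trans (T.above_trans hc₁ (T.above_of_edge hs₁))
      (T.above_of_edge_of_ne hs₁' h (Ne.symm e)), hd₂⟩
  · exact ⟨c₁, d₁, h₁, hc₁, T.above_trans (T.above_trans hd₂ (T.above_of_edge hs₂'))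
      (T.above_of_edge_of_ne hs₂ h e)⟩

theorem LeftOf.not_leftOf {T : PlanarTree I} {a b : I} (h : T.LeftOf a b) : ¬ T.LeftOf b a :=
  fun h' => T.leftOf_irrefl a (T.leftOf_trans h h')

/-- Induction along the path from the root up to `a`. Only a vertex `b` strictly above the successor
`s` of `a` needs an argument: its branch at `s` is either that of `a` or a sibling of `a`. -/
theorem above_or_leftOf (T : PlanarTree I) (a b : I) :
    T.Above a b ∨ T.Above b a ∨ T.LeftOf a b ∨ T.LeftOf b a := by
  obtain ⟨r, hr⟩ := T.exists_forall_above
  have key : ∀ a, Relation.ReflTransGen T.edge a r →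
      T.Above a b ∨ T.Above b a ∨ T.LeftOf a b ∨ T.LeftOf b a := by
    intro a ha
    induction ha using Relation.ReflTransGen.head_induction_on with
    | refl => exact .inr (.inl (hr b))
    | @head a s has _ ih =>
      have has' := T.above_of_edge has
      rcases ih with h | h | h | h
      · exact .inl (T.above_trans has' h)
      · rcases Relation.ReflTransGen.cases_tail h with e | ⟨d, hbd, hds⟩
        · exact .inl (e ▸ has')
        · by_cases e : a = d
          · exact .inr (.inl (e ▸ hbd))
          · rcases T.left_total has hds e with h | h
            · exact .inr (.inr (.inl ⟨a, d, h, T.above_refl a, hbd⟩))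
            · exact .inr (.inr (.inr ⟨d, a, h, hbd, T.above_refl a⟩))
      · exact .inr (.inr (.inl (h.mono has' (T.above_refl b))))
      · exact .inr (.inr (.inr (h.mono (T.above_refl b) has')))
  exact key a (hr a)

theorem left_of_leftOf (T : PlanarTree I) {a b s : I} (h : T.LeftOf a b) (ha : T.edge a s)
    (hb : T.edge b s) : T.left a b := by
  have hne : a ≠ b := by
    rintro rfl
    exact T.leftOf_irrefl a h
  exact (T.left_total ha hb hne).resolve_right fun h' => h.not_leftOf (T.leftOf_of_left h')

theorem left_iff (T : PlanarTree I) {a b : I} :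
    T.left a b ↔ (∃ s, T.edge a s ∧ T.edge b s) ∧ T.LeftOf a b :=
  ⟨fun h => ⟨T.siblings_of_left h, T.leftOf_of_left h⟩,
    fun ⟨⟨_, ha, hb⟩, h⟩ => T.left_of_leftOf h ha hb⟩

theorem ext_rel {T S : PlanarTree I} (h : ∀ a b, T.Above a b ↔ S.Above a b)
    (h' : ∀ a b, T.LeftOf a b ↔ S.LeftOf a b) : T = S := by
  have e : T.toNonplanarTree = S.toNonplanarTree := NonplanarTree.ext_above h
  have e' : T.edge = S.edge := congrArg NonplanarTree.edge e
  refine PlanarTree.ext e' ?_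
  ext a b
  rw [left_iff, left_iff, e']
  simp only [h']

/-- If an embedding respects the two orders of planar trees in one direction, then it reflects
the left-to-right order. -/
theorem leftOf_iff_of_imp {T : PlanarTree I} {X : PlanarTree J} {ι : I → J}
    (hV : ∀ a b, T.Above a b → X.Above (ι a) (ι b))
    (hH : ∀ a b, T.LeftOf a b → X.LeftOf (ι a) (ι b)) (a b : I) :
    X.LeftOf (ι a) (ι b) ↔ T.LeftOf a b := by
  refine ⟨fun h => ?_, hH a b⟩
  -- One of four alternatives always holds in `T`, and their images in `X` exclude `LeftOf (ι a) (ι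
  -- b)` in all cases but the desired one.
  rcases T.above_or_leftOf a b with h' | h' | h' | h'
  · exact absurd (hV _ _ h') h.not_above
  · exact absurd (hV _ _ h') h.not_above'
  · exact h'
  · exact absurd (hH _ _ h') h.not_leftOf

theorem above_map (T : PlanarTree I) (σ : I ≃ J) (a b : J) :
    (T.map σ).Above a b ↔ T.Above (σ.symm a) (σ.symm b) :=
  T.toNonplanarTree.above_map σ a b

theorem leftOf_map (T : PlanarTree I) (σ : I ≃ J) (a b : J) :
    (T.map σ).LeftOf a b ↔ T.LeftOf (σ.symm a) (σ.symm b) := by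
  constructor
  · rintro ⟨c, d, h, hc, hd⟩
    exact ⟨σ.symm c, σ.symm d, h, (T.above_map σ _ _).1 hc, (T.above_map σ _ _).1 hd⟩
  · rintro ⟨c, d, h, hc, hd⟩
    refine ⟨σ c, σ d, ?_, (T.above_map σ _ _).2 (by simpa using hc),
      (T.above_map σ _ _).2 (by simpa using hd)⟩
    simpa [map] using h

theorem map_map {K : Type} (T : PlanarTree I) (σ : I ≃ J) (τ : J ≃ K) :
    (T.map σ).map τ = T.map (σ.trans τ) := rfl

theorem map_refl (T : PlanarTree I) : T.map (Equiv.refl I) = T := rfl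

/-- The two orders of a planar rooted tree, restricted to a subset with a smallest element, are
the orders of a planar rooted tree. -/
theorem exists_restrict [Finite I] (X : PlanarTree J) {ι : I → J} (hι : ι.Injective) (r : I)
    (hr : ∀ a, X.Above (ι a) (ι r)) :
    ∃ T : PlanarTree I, (∀ a b, T.Above a b ↔ X.Above (ι a) (ι b)) ∧
      ∀ a b, T.LeftOf a b ↔ X.LeftOf (ι a) (ι b) := by
  obtain ⟨T, hT⟩ := X.toNonplanarTree.exists_restrict hι r hr
  let P : PlanarTree I :=
    { toNonplanarTree := T
      left := fun a b => (∃ s, T.edge a s ∧ T.edge b s) ∧ X.LeftOf (ι a) (ι b)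
      siblings_of_left := fun h => h.1
      left_irrefl := fun a h => X.leftOf_irrefl _ h.2
      left_trans := by
        rintro a b c ⟨⟨s, ha, hb⟩, h⟩ ⟨⟨t, hb', hc⟩, h'⟩
        cases T.edge_unique hb hb'
        exact ⟨⟨s, ha, hc⟩, X.leftOf_trans h h'⟩
      left_total := by
        intro a b s ha hb hne
        -- Siblings are incomparable in `T`, hence in `X`, so `LeftOf` must decide between them.
        have key : ∀ {a b}, T.edge a s → T.edge b s → a ≠ b → ¬ X.Above (ι a) (ι b) :=
          fun ha hb hne h => T.not_above_of_edge hb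
            (T.above_of_edge_of_ne ha ((hT _ _).2 h) hne.symm)
        rcases X.above_or_leftOf (ι a) (ι b) with h | h | h | h
        · exact absurd h (key ha hb hne)
        · exact absurd h (key hb ha hne.symm)
        · exact .inl ⟨⟨s, ha, hb⟩, h⟩
        · exact .inr ⟨⟨s, hb, ha⟩, h⟩ }
  refine ⟨P, hT, fun a b => (leftOf_iff_of_imp (fun a b => (hT a b).1) ?_ a b).symm⟩
  rintro a b ⟨c, d, h, hc, hd⟩
  exact h.2.mono ((hT _ _).1 hc) ((hT _ _).1 hd)

end PlanarTree

/-! ## Substitution in terms of the orders -/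

namespace NonplanarTree

variable {I J : Type}

/-- `X` is obtained from `T` by substituting `S` for the vertex `j`, in terms of the orders. -/
structure IsInsertion (T : NonplanarTree J) (j : J) (S : NonplanarTree I)
    (X : NonplanarTree ({x : J // x ≠ j} ⊕ I)) : Prop where
  inl_inl : ∀ x y, X.Above (.inl x) (.inl y) ↔ T.Above x.1 y.1
  inr_inr : ∀ s t, X.Above (.inr s) (.inr t) ↔ S.Above s t
  inr_inl : ∀ s x, X.Above (.inr s) (.inl x) ↔ T.Above j x.1
  inl_inr : ∀ x {r}, (∀ s, S.Above s r) → (X.Above (.inl x) (.inr r) ↔ T.Above x.1 j)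

theorem IsInsertion.above_inr {T : NonplanarTree J} {j : J} {S : NonplanarTree I}
    {X : NonplanarTree ({x : J // x ≠ j} ⊕ I)} (h : IsInsertion T j S X) {x : {x : J // x ≠ j}}
    {s : I} (hs : X.Above (.inl x) (.inr s)) : T.Above x.1 j := by
  obtain ⟨r, hr⟩ := S.exists_forall_above
  exact (h.inl_inr x hr).1 (X.above_trans hs ((h.inr_inr s r).2 (hr s)))

theorem IsInsertion.not_above {T : NonplanarTree J} {j : J} {S : NonplanarTree I}
    {X : NonplanarTree ({x : J // x ≠ j} ⊕ I)} (h : IsInsertion T j S X) {x : {x : J // x ≠ j}}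
    {s t : I} (hs : X.Above (.inl x) (.inr s)) (ht : X.Above (.inr t) (.inl x)) : False :=
  x.2 (T.above_antisymm (h.above_inr hs) ((h.inr_inl t x).1 ht))

/-- `S` is the restriction of `X` to `I`, and `T` its restriction to `J` with the root of `S` in the
place of `j`. This disjointness of the sets of insertions prevents multiplicities in iterated
compositions. -/
theorem IsInsertion.unique {T T' : NonplanarTree J} {j : J} {S S' : NonplanarTree I}
    {X : NonplanarTree ({x : J // x ≠ j} ⊕ I)} (h : IsInsertion T j S X)
    (h' : IsInsertion T' j S' X) : T = T' ∧ S = S' := by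
  have e : S = S' := ext_above fun a b => by rw [← h.inr_inr, h'.inr_inr]
  subst e
  obtain ⟨r, hr⟩ := S.exists_forall_above
  refine ⟨ext_above fun a b => ?_, rfl⟩
  by_cases ha : a = j <;> by_cases hb : b = j
  · subst ha hb
    simp only [above_refl]
  · subst ha
    rw [← h.inr_inl r ⟨b, hb⟩, ← h'.inr_inl r ⟨b, hb⟩]
  · subst hb
    rw [← h.inl_inr ⟨a, ha⟩ hr, ← h'.inl_inr ⟨a, ha⟩ hr]
  · rw [← h.inl_inl ⟨a, ha⟩ ⟨b, hb⟩, ← h'.inl_inl ⟨a, ha⟩ ⟨b, hb⟩]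

/-- The vertex of `T` that a vertex of `T ∘_j S` comes from. -/
def collapse (j : J) : {x : J // x ≠ j} ⊕ I → J
  | .inl x => x
  | .inr _ => j

theorem collapse_above (T : NonplanarTree J) (j : J) (S : NonplanarTree I) (f : T.Entr j → I)
    {a b : {x : J // x ≠ j} ⊕ I} (h : (T.insert j S f).Above a b) :
    T.Above (collapse j a) (collapse j b) := by
  induction h with
  | refl => exact T.above_refl _
  | @tail b c _ h ih =>
    refine T.above_trans ih ?_
    rcases b with x | s <;> rcases c with y | t
    · exact T.above_of_edge h
    · exact T.above_of_edge h.1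
    · exact T.above_of_edge h.2
    · exact T.above_refl _

theorem insert_inr_above (T : NonplanarTree J) (j : J) (S : NonplanarTree I) (f : T.Entr j → I)
    {s t : I} (h : S.Above s t) : (T.insert j S f).Above (.inr s) (.inr t) :=
  Relation.ReflTransGen.lift (r := S.edge) (p := (T.insert j S f).edge) Sum.inr
    (fun _ _ h => h) _ _ h

theorem insert_inr_above_iff (T : NonplanarTree J) (j : J) (S : NonplanarTree I)
    (f : T.Entr j → I) (s t : I) :
    (T.insert j S f).Above (.inr s) (.inr t) ↔ S.Above s t := by
  refine ⟨fun h => ?_, T.insert_inr_above j S f⟩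
  have key : ∀ a, (T.insert j S f).Above a (.inr t) → ∀ s, a = .inr s → S.Above s t := by
    intro a h
    induction h using Relation.ReflTransGen.head_induction_on with
    | refl => rintro s ⟨⟩; exact S.above_refl _
    | @head a c hac hct ih =>
      rintro s rfl
      rcases c with y | u
      -- A path leaving `S` continues at the successor of `j` in `T`; returning to `S` would give a
      -- cycle after collapsing `S` to `j`.
      · exact absurd (T.collapse_above j S f hct) (T.not_above_of_edge hac.2)
      · exact S.above_trans (S.above_of_edge hac) (ih u rfl)
  exact key _ h s rfl

open Classical in
/-- The vertices of `T` as vertices of `T ∘_j S`, where `j` corresponds to the vertex `r`. -/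
noncomputable def expand (j : J) (r : I) (x : J) : {x : J // x ≠ j} ⊕ I :=
  if h : x = j then .inr r else .inl ⟨x, h⟩

theorem expand_self (j : J) (r : I) : expand j r j = .inr r := by simp [expand]

theorem expand_of_ne (j : J) (r : I) {x : J} (h : x ≠ j) : expand j r x = .inl ⟨x, h⟩ := by
  simp [expand, h]

theorem expand_val (j : J) (r : I) (x : {x : J // x ≠ j}) : expand j r x.1 = .inl x :=
  expand_of_ne j r x.2

/-- An edge entering `j` now ends somewhere in `S`, from where the path goes on to the root `r`; the
edge leaving `j` leaves from `r`. -/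
theorem insert_expand_above (T : NonplanarTree J) (j : J) (S : NonplanarTree I)
    (f : T.Entr j → I) {r : I} (hr : ∀ s, S.Above s r) {x y : J} (h : T.Above x y) :
    (T.insert j S f).Above (expand j r x) (expand j r y) := by
  induction h with
  | refl => exact above_refl _ _
  | @tail b c _ h ih =>
    refine above_trans _ ih ?_
    have hne := T.ne_of_edge h
    by_cases hb : b = j
    · subst hb
      rw [expand_self, expand_of_ne b r hne.symm]
      exact above_of_edge _ ⟨S.isRoot_iff.2 hr, h⟩
    · rw [expand_of_ne j r hb]
      by_cases hc : c = j
      · subst hc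
        rw [expand_self]
        exact above_trans _ (above_of_edge (T.insert c S f) (b := .inr (f ⟨b, h⟩)) ⟨h, rfl⟩)
          (T.insert_inr_above c S f (hr _))
      · rw [expand_of_ne j r hc]
        exact above_of_edge _ h

theorem isInsertion_insert (T : NonplanarTree J) (j : J) (S : NonplanarTree I)
    (f : T.Entr j → I) : IsInsertion T j S (T.insert j S f) where
  inl_inl x y := by
    obtain ⟨r, hr⟩ := S.exists_forall_above
    refine ⟨fun h => T.collapse_above j S f h, fun h => ?_⟩
    simpa only [expand_val] using T.insert_expand_above j S f hr h
  inr_inr := T.insert_inr_above_iff j S f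
  inr_inl s x := by
    obtain ⟨r, hr⟩ := S.exists_forall_above
    refine ⟨fun h => T.collapse_above j S f h,
      fun h => above_trans _ (T.insert_inr_above j S f (hr s)) ?_⟩
    simpa only [expand_val, expand_self] using T.insert_expand_above j S f hr h
  inl_inr x r hr := by
    refine ⟨fun h => T.collapse_above j S f h, fun h => ?_⟩
    simpa only [expand_val, expand_self] using T.insert_expand_above j S f hr h

theorem insert_injective (T : NonplanarTree J) (j : J) (S : NonplanarTree I) :
    Function.Injective (T.insert j S) := by
  intro f g h
  funext ⟨x, hx⟩
  have : (T.insert j S g).edge (.inl ⟨x, T.ne_of_edge hx⟩) (.inr (f ⟨x, hx⟩)) := by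
    rw [← h]
    exact ⟨hx, rfl⟩
  obtain ⟨_, h⟩ := this
  exact h.symm

section

variable {T : NonplanarTree J} {j : J} {S : NonplanarTree I}
  {X : NonplanarTree ({x : J // x ≠ j} ⊕ I)}

/-- The path from `x` to the root of `S` must enter `S` at once: a first step to a vertex `y` of `T`
would place `y` between `x` and its successor `j`. -/
theorem IsInsertion.exists_edge (h : IsInsertion T j S X) {x : J} (hx : T.edge x j) :
    ∃ s, X.edge (.inl ⟨x, T.ne_of_edge hx⟩) (.inr s) := by
  obtain ⟨r, hr⟩ := S.exists_forall_above
  have hxr := (h.inl_inr ⟨x, T.ne_of_edge hx⟩ hr).2 (T.above_of_edge hx)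
  rcases Relation.ReflTransGen.cases_head hxr with e | ⟨y | s, hy, hyr⟩
  · cases e
  · refine absurd (h.above_inr hyr) fun h' => ?_
    have hne : y.1 ≠ x := fun e => X.ne_of_edge hy (congrArg Sum.inl (Subtype.ext e.symm))
    exact y.2 (T.above_antisymm h'
      (T.above_of_edge_of_ne hx ((h.inl_inl _ _).1 (X.above_of_edge hy)) hne))
  · exact ⟨s, hy⟩

/-- The vertices of `T` below a vertex of `S` are the same for all vertices of `S`, so they do not
affect which pairs inside `S` are covers. -/
theorem IsInsertion.edge_inr_inr (h : IsInsertion T j S X) (s t : I) :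
    X.edge (.inr s) (.inr t) ↔ S.edge s t := by
  rw [edge_iff, edge_iff, h.inr_inr, ne_eq, Sum.inr.injEq]
  refine and_congr_right fun _ => and_congr_right fun _ => ⟨fun H c hc hne => ?_, ?_⟩
  · exact (h.inr_inr t c).1 (H (.inr c) ((h.inr_inr s c).2 hc) fun e => hne (Sum.inr_injective e))
  · rintro H (x | c) hc hne
    · exact (h.inr_inl _ _).2 ((h.inr_inl _ _).1 hc)
    · exact (h.inr_inr t c).2 (H c ((h.inr_inr s c).1 hc) fun e => hne (congrArg Sum.inr e))

theorem IsInsertion.edge_inl_inl (h : IsInsertion T j S X) {x y : {x : J // x ≠ j}}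
    (hxy : T.edge x y) : X.edge (.inl x) (.inl y) := by
  have hne := T.ne_of_edge hxy
  have hV := (h.inl_inl x y).2 (T.above_of_edge hxy)
  refine X.edge_iff.2 ⟨hV, fun e => hne (congrArg Subtype.val (Sum.inl_injective e)), ?_⟩
  rintro (z | s) hc hcne
  · exact (h.inl_inl y z).2 (T.above_of_edge_of_ne hxy ((h.inl_inl x z).1 hc)
      fun e => hcne (congrArg Sum.inl (Subtype.ext e)))
  -- A vertex of `S` between `x` and `y` would place `j` between the ends of an edge of `T`.
  · refine (X.above_total hV hc).resolve_right fun h' => ?_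
    exact y.2 (T.above_antisymm
      (T.above_of_edge_of_ne hxy (h.above_inr hc) x.2.symm) ((h.inr_inl s y).1 h'))

theorem IsInsertion.edge_inr_inl (h : IsInsertion T j S X) {s : I} {y : {x : J // x ≠ j}}
    (hs : S.IsRoot s) (hy : T.edge j y) : X.edge (.inr s) (.inl y) := by
  refine X.edge_iff.2 ⟨(h.inr_inl s y).2 (T.above_of_edge hy), Sum.inr_ne_inl, ?_⟩
  rintro (z | t) hc hcne
  · exact (h.inl_inl y z).2 (T.above_of_edge_of_ne hy ((h.inr_inl s z).1 hc) z.2)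
  · exact absurd (congrArg Sum.inr (S.eq_of_above_of_isRoot ((h.inr_inr s t).1 hc) hs)) hcne.symm

theorem IsInsertion.insert_eq (h : IsInsertion T j S X) {f : T.Entr j → I}
    (hf : ∀ x : T.Entr j, X.edge (.inl ⟨x.1, T.ne_of_edge x.2⟩) (.inr (f x))) :
    T.insert j S f = X := by
  refine eq_of_edge_imp ?_
  rintro (x | s) (y | t) hab
  · exact h.edge_inl_inl hab
  · obtain ⟨hx, rfl⟩ := hab
    exact hf ⟨x.1, hx⟩
  · exact h.edge_inr_inl hab.1 hab.2
  · exact (h.edge_inr_inr s t).2 hab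

end

/-- The attaching vertex of each edge entering `j` is read off from `X`; by `eq_of_edge_imp` it is
enough that all edges of the resulting insertion are edges of `X`. -/
theorem range_insert (T : NonplanarTree J) (j : J) (S : NonplanarTree I) :
    Set.range (T.insert j S) = {X | IsInsertion T j S X} := by
  ext X
  constructor
  · rintro ⟨f, rfl⟩
    exact T.isInsertion_insert j S f
  · intro h
    choose f hf using fun x : T.Entr j => IsInsertion.exists_edge h x.2
    exact ⟨f, IsInsertion.insert_eq h hf⟩

end NonplanarTree

/-! ### Substitution of planar trees in terms of the two orders -/

namespace PlanarTree

variable {I J : Type}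

/-- `X` is obtained from `T` by substituting `S` for the vertex `j`, in terms of the orders. -/
structure IsInsertion (T : PlanarTree J) (j : J) (S : PlanarTree I)
    (X : PlanarTree ({x : J // x ≠ j} ⊕ I)) : Prop where
  above : NonplanarTree.IsInsertion T.toNonplanarTree j S.toNonplanarTree X.toNonplanarTree
  inl_inl : ∀ x y, X.LeftOf (.inl x) (.inl y) ↔ T.LeftOf x.1 y.1
  inr_inr : ∀ s t, X.LeftOf (.inr s) (.inr t) ↔ S.LeftOf s t
  inr_inl : ∀ x {r}, (∀ s, S.Above s r) → (X.LeftOf (.inr r) (.inl x) ↔ T.LeftOf j x.1)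
  inl_inr : ∀ x {r}, (∀ s, S.Above s r) → (X.LeftOf (.inl x) (.inr r) ↔ T.LeftOf x.1 j)

theorem IsInsertion.unique {T T' : PlanarTree J} {j : J} {S S' : PlanarTree I}
    {X : PlanarTree ({x : J // x ≠ j} ⊕ I)} (h : IsInsertion T j S X)
    (h' : IsInsertion T' j S' X) : T = T' ∧ S = S' := by
  obtain ⟨eT, eS⟩ := h.above.unique h'.above
  have e : S = S' := ext_rel (fun a b => by rw [eS]) fun a b => by rw [← h.inr_inr, h'.inr_inr]
  subst e
  obtain ⟨r, hr⟩ := S.exists_forall_above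
  refine ⟨ext_rel (fun a b => by rw [eT]) fun a b => ?_, rfl⟩
  by_cases ha : a = j <;> by_cases hb : b = j
  · subst ha hb
    simp only [leftOf_irrefl]
  · subst ha
    rw [← h.inr_inl ⟨b, hb⟩ hr, ← h'.inr_inl ⟨b, hb⟩ hr]
  · subst hb
    rw [← h.inl_inr ⟨a, ha⟩ hr, ← h'.inl_inr ⟨a, ha⟩ hr]
  · rw [← h.inl_inl ⟨a, ha⟩ ⟨b, hb⟩, ← h'.inl_inl ⟨a, ha⟩ ⟨b, hb⟩]

open NonplanarTree (expand expand_self expand_of_ne expand_val)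

theorem insert_inr_leftOf (T : PlanarTree J) (j : J) (S : PlanarTree I) (f : T.Attaching j S)
    {s t : I} (h : S.LeftOf s t) : (T.insert j S f).LeftOf (.inr s) (.inr t) := by
  obtain ⟨c, d, h, hc, hd⟩ := h
  exact ⟨.inr c, .inr d, h, NonplanarTree.insert_inr_above _ _ _ _ hc,
    NonplanarTree.insert_inr_above _ _ _ _ hd⟩

theorem insert_expand_leftOf_of_left (T : PlanarTree J) (j : J) (S : PlanarTree I)
    (f : T.Attaching j S) {r : I} (hr : ∀ s, S.Above s r) {x y : J} (h : T.left x y) :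
    (T.insert j S f).LeftOf (expand j r x) (expand j r y) := by
  set X := T.insert j S f
  obtain ⟨p, hx, hy⟩ := T.siblings_of_left h
  have inS : ∀ {s t}, S.Above s t → X.Above (.inr s) (.inr t) :=
    fun h => NonplanarTree.insert_inr_above _ _ _ _ h
  by_cases hp : p = j
  · subst hp
    rw [expand_of_ne p r (T.ne_of_edge hx), expand_of_ne p r (T.ne_of_edge hy)]
    have ex : X.Above (.inl ⟨x, T.ne_of_edge hx⟩) (.inr (f.1 ⟨x, hx⟩).vertex) :=
      X.above_of_edge ⟨hx, rfl⟩
    have ey : X.Above (.inl ⟨y, T.ne_of_edge hy⟩) (.inr (f.1 ⟨y, hy⟩).vertex) :=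
      X.above_of_edge ⟨hy, rfl⟩
    -- Monotonicity of `f` enters here. Each clause of the order of angles names the siblings that
    -- separate `x` from `y`: the two edges themselves, an edge and a branch of `S`, or two branches
    -- of `S`.
    rcases f.2 ⟨x, hx⟩ ⟨y, hy⟩ h with ⟨hv, _⟩ | ⟨c, hc, hcl, hac⟩ | ⟨c, hc, hcl, hac⟩ |
      ⟨c, d, hcd, hac, had⟩
    · exact X.leftOf_of_left ⟨h, fun _ _ => hv⟩
    · exact ⟨.inl ⟨x, T.ne_of_edge hx⟩, .inr c, Or.inl ⟨hx, hc, hcl⟩,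
        X.above_refl _, X.above_trans ey (inS hac)⟩
    · exact ⟨.inr c, .inl ⟨y, T.ne_of_edge hy⟩, Or.inl ⟨hy, hcl⟩,
        X.above_trans ex (inS hac), X.above_refl _⟩
    · exact ⟨.inr c, .inr d, hcd, X.above_trans ex (inS hac), X.above_trans ey (inS had)⟩
  · by_cases hxj : x = j
    · subst hxj
      have hyx : y ≠ x := by
        rintro rfl
        exact T.left_irrefl _ h
      rw [expand_self, expand_of_ne x r hyx]
      exact X.leftOf_of_left (.inr ⟨h, S.isRoot_iff.2 hr⟩)
    · rw [expand_of_ne j r hxj]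
      by_cases hyj : y = j
      · subst hyj
        rw [expand_self]
        exact X.leftOf_of_left (.inr ⟨h, S.isRoot_iff.2 hr⟩)
      · rw [expand_of_ne j r hyj]
        exact X.leftOf_of_left ⟨h, fun hxj => absurd (T.edge_unique hx hxj) hp⟩

theorem isInsertion_insert (T : PlanarTree J) (j : J) (S : PlanarTree I) (f : T.Attaching j S) :
    IsInsertion T j S (T.insert j S f) := by
  -- By `leftOf_iff_of_imp` only the implication from `T` to the insertion has to be proved, and for
  -- it only the case of siblings.
  have inJ : ∀ {r}, (∀ s, S.Above s r) → ∀ x y,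
      (T.insert j S f).LeftOf (expand j r x) (expand j r y) ↔ T.LeftOf x y := fun hr => by
    refine leftOf_iff_of_imp
      (fun x y h => NonplanarTree.insert_expand_above _ _ _ _ hr h) ?_
    rintro x y ⟨c, d, h, hc, hd⟩
    exact (T.insert_expand_leftOf_of_left j S f hr h).mono
      (NonplanarTree.insert_expand_above _ _ _ _ hr hc)
      (NonplanarTree.insert_expand_above _ _ _ _ hr hd)
  refine ⟨NonplanarTree.isInsertion_insert _ _ _ _, fun x y => ?_, ?_, fun x r hr => ?_,
    fun x r hr => ?_⟩
  · obtain ⟨r, hr⟩ := S.exists_forall_above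
    simpa only [expand_val] using inJ hr x.1 y.1
  · exact leftOf_iff_of_imp (X := T.insert j S f) (ι := Sum.inr)
      (fun s t h => NonplanarTree.insert_inr_above _ _ _ _ h)
      fun s t h => T.insert_inr_leftOf j S f h
  · simpa only [expand_val, expand_self] using inJ hr j x.1
  · simpa only [expand_val, expand_self] using inJ hr x.1 j

theorem not_left_of_edge (T : PlanarTree I) {a b : I} (h : T.edge a b) :
    ¬ T.left a b ∧ ¬ T.left b a :=
  ⟨fun h' => (T.leftOf_of_left h').not_above (T.above_of_edge h),
    fun h' => (T.leftOf_of_left h').not_above' (T.above_of_edge h)⟩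

theorem insert_injective (T : PlanarTree J) (j : J) (S : PlanarTree I) :
    Function.Injective (T.insert j S) := by
  intro f g h
  have hv := NonplanarTree.insert_injective _ _ _ (congrArg PlanarTree.toNonplanarTree h)
  refine Subtype.ext (funext fun x => Angle.ext (congrFun hv x) (Set.ext fun s => ?_))
  -- The angle of `x` is visible in the insertion: its left part consists of the vertices of `S`
  -- that are left siblings of `x`.
  have key : ∀ f : T.Attaching j S, (T.insert j S f).left (.inr s)
      (.inl ⟨x.1, T.ne_of_edge x.2⟩) ↔ s ∈ (f.1 x).lower := by
    intro f
    constructor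
    · rintro (⟨_, h⟩ | ⟨h, _⟩)
      · exact h
      · exact absurd h (T.not_left_of_edge x.2).2
    · exact fun h => .inl ⟨x.2, h⟩
  rw [← key f, ← key g, h]

section

variable {T : PlanarTree J} {j : J} {S : PlanarTree I} {X : PlanarTree ({x : J // x ≠ j} ⊕ I)}

theorem IsInsertion.left_inr_inr (h : IsInsertion T j S X) {s t : I} :
    X.left (.inr s) (.inr t) ↔ S.left s t := by
  constructor
  · intro hst
    obtain ⟨x | u, hs, ht⟩ := X.siblings_of_left hst
    · have hT := (h.above.inr_inl s x).1 (X.above_of_edge hs)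
      obtain ⟨r, hr⟩ := S.exists_forall_above
      -- Only the root of `S` can have its successor outside `S`, so distinct siblings from `S` have
      -- their common successor in `S`.
      have key : ∀ s, X.edge (.inr s) (.inl x) → s = r := by
        intro s hs
        by_contra hne
        refine h.above.not_above (X.above_of_edge_of_ne hs ((h.above.inr_inr s r).2 (hr s)) ?_)
          (X.above_of_edge hs)
        exact fun e => hne (Sum.inr_injective e).symm
      rw [key s hs, key t ht] at hst
      exact absurd hst (X.left_irrefl _)
    · exact S.left_of_leftOf ((h.inr_inr s t).1 (X.leftOf_of_left hst))
        ((h.above.edge_inr_inr s u).1 hs) ((h.above.edge_inr_inr t u).1 ht)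
  · intro hst
    obtain ⟨u, hs, ht⟩ := S.siblings_of_left hst
    exact X.left_of_leftOf ((h.inr_inr s t).2 (S.leftOf_of_left hst))
      ((h.above.edge_inr_inr s u).2 hs) ((h.above.edge_inr_inr t u).2 ht)

/-- The angle of `S` into which the edge leaving `x` is drawn in `X`. -/
def IsInsertion.angle (h : IsInsertion T j S X) {x : {x : J // x ≠ j}} {s : I}
    (hx : X.edge (.inl x) (.inr s)) : Angle S where
  vertex := s
  lower := {c | X.left (.inr c) (.inl x)}
  edge_of_mem {c} hc := by
    obtain ⟨u, hu, hu'⟩ := X.siblings_of_left hc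
    cases X.edge_unique hx hu'
    exact (h.above.edge_inr_inr c s).1 hu
  mem_of_left hc hd := X.left_trans (h.left_inr_inr.2 hd) hc

/-- A vertex of `T` below one vertex of `S` is below all of them, hence below `y`. Then `y` would
lie in the disjoint subtrees of both `c` and `d`. -/
theorem IsInsertion.exists_inr_of_left_of_above (h : IsInsertion T j S X)
    {c d : {x : J // x ≠ j} ⊕ I} {y : {x : J // x ≠ j}} {s t : I} (hcd : X.left c d ∨ X.left d c)
    (hy : X.edge (.inl y) (.inr t)) (hc : X.Above (.inr s) c) (hd : X.Above (.inl y) d) :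
    ∃ u, c = .inr u := by
  rcases c with z | u
  · have hz := X.above_trans (X.above_of_edge hy)
      ((h.above.inr_inl t z).2 ((h.above.inr_inl s z).1 hc))
    rcases hcd with h' | h'
    · exact (X.false_of_left_of_above h' hz hd).elim
    · exact (X.false_of_left_of_above h' hd hz).elim
  · exact ⟨u, rfl⟩

/-- Let `c` and `d` be the siblings separating `x` from `y`. Whether `c` is `x` itself and whether
`d` is `y` itself selects one of the four clauses of the order of angles; a separating vertex other
than these lies in `S`. -/
theorem IsInsertion.angle_le_angle (h : IsInsertion T j S X) {x y : {x : J // x ≠ j}} {s t : I}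
    (hx : X.edge (.inl x) (.inr s)) (hy : X.edge (.inl y) (.inr t))
    (hxy : X.LeftOf (.inl x) (.inl y)) : h.angle hx ≤ h.angle hy := by
  obtain ⟨c, d, hcd, hc, hd⟩ := hxy
  by_cases ec : c = .inl x
  · subst ec
    by_cases ed : d = .inl y
    · subst ed
      obtain ⟨u, hu, hu'⟩ := X.siblings_of_left hcd
      cases X.edge_unique hx hu
      cases X.edge_unique hy hu'
      exact .inl ⟨rfl, fun c hc => X.left_trans hc hcd⟩
    · have hd' := X.above_of_edge_of_ne hy hd ed
      obtain ⟨d, rfl⟩ := h.exists_inr_of_left_of_above (.inr hcd) hx hd' hc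
      obtain ⟨u, hu, hu'⟩ := X.siblings_of_left hcd
      cases X.edge_unique hx hu
      exact .inr (.inl ⟨d, (h.above.edge_inr_inr d s).1 hu',
        fun h' => X.left_irrefl _ (X.left_trans hcd h'), (h.above.inr_inr t d).1 hd'⟩)
  · have hc' := X.above_of_edge_of_ne hx hc ec
    obtain ⟨c, rfl⟩ := h.exists_inr_of_left_of_above (.inl hcd) hy hc' hd
    by_cases ed : d = .inl y
    · subst ed
      obtain ⟨u, hu, hu'⟩ := X.siblings_of_left hcd
      cases X.edge_unique hy hu'
      exact .inr (.inr (.inl ⟨c, (h.above.edge_inr_inr c t).1 hu, hcd,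
        (h.above.inr_inr s c).1 hc'⟩))
    · have hd' := X.above_of_edge_of_ne hy hd ed
      obtain ⟨d, rfl⟩ := h.exists_inr_of_left_of_above (.inr hcd) hx hd' hc
      exact .inr (.inr (.inr ⟨c, d, h.left_inr_inr.1 hcd, (h.above.inr_inr s c).1 hc',
        (h.above.inr_inr t d).1 hd'⟩))

theorem eq_of_left_imp {P Q : PlanarTree I} (h : P.toNonplanarTree = Q.toNonplanarTree)
    (h' : ∀ a b, P.left a b → Q.left a b) : P = Q := by
  have e : P.edge = Q.edge := congrArg NonplanarTree.edge h
  refine PlanarTree.ext e ?_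
  ext a b
  refine ⟨h' a b, fun hab => ?_⟩
  obtain ⟨s, hs, hs'⟩ := Q.siblings_of_left hab
  rw [← e] at hs hs'
  have hne : a ≠ b := by
    rintro rfl
    exact Q.left_irrefl _ hab
  exact (P.left_total hs hs' hne).resolve_right
    fun hba => Q.left_irrefl _ (Q.left_trans hab (h' _ _ hba))

/-- The angles read off from `X` form an increasing map by `angle_le_angle`. The underlying trees
agree by the non-planar case, and a total order on each set of siblings that is contained in another
one equals it. -/
theorem IsInsertion.exists_insert_eq (h : IsInsertion T j S X) : ∃ f, T.insert j S f = X := by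
  choose g hg using fun x : T.Entr j => h.above.exists_edge x.2
  let f : T.Attaching j S := ⟨fun x => h.angle (hg x), fun x y hxy =>
    h.angle_le_angle (hg x) (hg y) ((h.inl_inl _ _).2 (T.leftOf_of_left hxy))⟩
  have hf : (T.insert j S f).toNonplanarTree = X.toNonplanarTree := h.above.insert_eq hg
  refine ⟨f, eq_of_left_imp hf ?_⟩
  have hX : ∀ {a b}, (T.insert j S f).left a b → X.LeftOf a b → X.left a b := by
    intro a b hab hl
    obtain ⟨s, hs, hs'⟩ := (T.insert j S f).siblings_of_left hab
    rw [hf] at hs hs'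
    exact X.left_of_leftOf hl hs hs'
  rintro (x | s) (y | t) hab
  · exact hX hab ((h.inl_inl x y).2 (T.leftOf_of_left hab.1))
  · have hab' := hab
    rcases hab with ⟨hx, ht, htl⟩ | ⟨hx, ht⟩
    · refine (X.left_total (hg ⟨x.1, hx⟩) ((h.above.edge_inr_inr t _).2 ht)
        Sum.inl_ne_inr).resolve_right htl
    · exact hX hab' ((h.inl_inr x (S.isRoot_iff.1 ht)).2 (T.leftOf_of_left hx))
  · have hab' := hab
    rcases hab with ⟨hy, hs⟩ | ⟨hy, hs⟩
    · exact hs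
    · exact hX hab' ((h.inr_inl y (S.isRoot_iff.1 hs)).2 (T.leftOf_of_left hy))
  · exact h.left_inr_inr.2 hab

end

theorem range_insert (T : PlanarTree J) (j : J) (S : PlanarTree I) :
    Set.range (T.insert j S) = {X | IsInsertion T j S X} := by
  ext X
  constructor
  · rintro ⟨f, rfl⟩
    exact T.isInsertion_insert j S f
  · exact fun h => IsInsertion.exists_insert_eq h

end PlanarTree

/-! ## Sums of basis elements -/

section setSum

open FreeAbelianGroup

variable {α β γ : Type}

/-- The sum of the elements of a finite set in the free abelian group. -/
noncomputable def setSum (s : Set α) : FreeAbelianGroup α := ∑ᶠ x ∈ s, of x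

theorem setSum_singleton (a : α) : setSum {a} = of a := finsum_mem_singleton

theorem setSum_eq_add_of_mem [Finite α] {s : Set α} {a : α} (ha : a ∈ s) :
    setSum s = of a + setSum (s \ {a}) := by
  rw [← setSum_singleton, setSum, setSum, setSum,
    ← finsum_mem_union Set.disjoint_sdiff_right (Set.toFinite _) (Set.toFinite _),
    Set.union_sdiff_cancel (Set.singleton_subset_iff.2 ha)]

theorem sum_of_eq_setSum [Fintype β] {f : β → α} (hf : f.Injective) :
    ∑ b, of (f b) = setSum (Set.range f) := by
  rw [setSum, finsum_mem_range hf, finsum_eq_sum_of_fintype]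

/-- By `hR` the sets `R a` are pairwise disjoint, so the sum over their union has no multiplicities.
-/
theorem map_setSum [Finite α] (g : FreeAbelianGroup α →+ FreeAbelianGroup γ) {R : α → Set γ}
    [Finite γ] (hg : ∀ a, g (of a) = setSum (R a))
    (hR : ∀ {a a' c}, c ∈ R a → c ∈ R a' → a = a') (A : Set α) :
    g (setSum A) = setSum {c | ∃ a ∈ A, c ∈ R a} := by
  have e : {c | ∃ a ∈ A, c ∈ R a} = ⋃ a ∈ A, R a := by
    ext c
    simp
  rw [e, setSum, setSum, AddMonoidHom.map_finsum_mem _ _ A.toFinite,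
    finsum_mem_biUnion (fun a _ a' _ hne => Set.disjoint_left.2 fun c h h' => hne (hR h h'))
      A.toFinite fun _ _ => Set.toFinite _]
  exact finsum_mem_congr rfl fun a _ => hg a

theorem map_equiv_setSum [Finite α] [Finite β] {f : α → β} (g : β → α)
    (hgf : ∀ a, g (f a) = a) (hfg : ∀ b, f (g b) = b) (A : Set α) :
    FreeAbelianGroup.map f (setSum A) = setSum {b | g b ∈ A} := by
  rw [map_setSum (R := fun a => {f a}) (FreeAbelianGroup.map f)
    (fun a => by rw [setSum_singleton, map_of_apply])]
  · congr 1
    ext b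
    constructor
    · rintro ⟨a, ha, rfl⟩
      simpa [hgf] using ha
    · exact fun h => ⟨g b, h, (hfg b).symm⟩
  · rintro a a' c rfl h
    rw [← hgf a, ← hgf a', Set.mem_singleton_iff.1 h]

/-- Applied to compositions, `R a b` is the set of insertions and `hR` is `IsInsertion.unique`. -/
theorem map₂_setSum [Finite α] [Finite β] [Finite γ]
    (m : FreeAbelianGroup α →+ FreeAbelianGroup β →+ FreeAbelianGroup γ) {R : α → β → Set γ}
    (hm : ∀ a b, m (of a) (of b) = setSum (R a b))
    (hR : ∀ {a a' b b' c}, c ∈ R a b → c ∈ R a' b' → a = a' ∧ b = b') (A : Set α) (B : Set β) :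
    m (setSum A) (setSum B) = setSum {c | ∃ a ∈ A, ∃ b ∈ B, c ∈ R a b} := by
  have key : ∀ b, m (setSum A) (of b) = setSum {c | ∃ a ∈ A, c ∈ R a b} := fun b =>
    map_setSum (m.flip (of b)) (R := fun a => R a b) (fun a => hm a b)
      (fun h h' => (hR h h').1) A
  rw [map_setSum (m (setSum A)) key]
  · congr 1
    ext c
    constructor
    · rintro ⟨b, hb, a, ha, h⟩
      exact ⟨a, ha, b, hb, h⟩
    · rintro ⟨a, ha, b, hb, h⟩
      exact ⟨b, hb, a, ha, h⟩
  · rintro b b' c ⟨a, _, h⟩ ⟨a', _, h'⟩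
    exact (hR h h').2

theorem lift_lift_of_of {M : Type} [AddCommGroup M] (F : α → β → M) (a : α) (b : β) :
    lift (fun a => lift (F a)) (of a) (of b) = F a b := by
  rw [lift_apply_of, lift_apply_of]

end setSum

/-! ### Composition and relabelling as operations on sets of trees -/

section comp

open FreeAbelianGroup

variable {I J : Type} [Finite I] [Nonempty I] [Finite J] [Nonempty J]

theorem PreLie.comp_of (j : J) (T : NonplanarTree J) (S : NonplanarTree I) :
    PreLie.comp j (of T) (of S) = setSum {X | NonplanarTree.IsInsertion T j S X} := by
  let := Fintype.ofFinite (T.Entr j → I)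
  rw [← NonplanarTree.range_insert, ← sum_of_eq_setSum (NonplanarTree.insert_injective T j S)]
  exact lift_lift_of_of _ T S

theorem PreLie.comp_setSum (j : J) (A : Set (NonplanarTree J)) (B : Set (NonplanarTree I)) :
    PreLie.comp j (setSum A) (setSum B) =
      setSum {X | ∃ T ∈ A, ∃ S ∈ B, NonplanarTree.IsInsertion T j S X} :=
  map₂_setSum (PreLie.comp j) (R := fun T S => {X | NonplanarTree.IsInsertion T j S X})
    (PreLie.comp_of j) (fun h h' => h.unique h') A B

theorem PreLie.map_of (σ : I ≃ J) (T : NonplanarTree I) :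
    PreLie.map σ (of T) = of (T.map σ) := map_of_apply _

theorem PreLie.map_setSum (σ : I ≃ J) (A : Set (NonplanarTree I)) :
    PreLie.map σ (setSum A) = setSum {X | X.map σ.symm ∈ A} :=
  map_equiv_setSum (NonplanarTree.map σ.symm)
    (fun T => by rw [T.map_map, σ.self_trans_symm, T.map_refl])
    (fun T => by rw [T.map_map, σ.symm_trans_self, T.map_refl]) A

theorem Brace.comp_of (j : J) (T : PlanarTree J) (S : PlanarTree I) :
    Brace.comp j (of T) (of S) = setSum {X | PlanarTree.IsInsertion T j S X} := by
  let := Fintype.ofFinite (T.Attaching j S)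
  rw [← PlanarTree.range_insert, ← sum_of_eq_setSum (PlanarTree.insert_injective T j S)]
  exact lift_lift_of_of _ T S

theorem Brace.comp_setSum (j : J) (A : Set (PlanarTree J)) (B : Set (PlanarTree I)) :
    Brace.comp j (setSum A) (setSum B) =
      setSum {X | ∃ T ∈ A, ∃ S ∈ B, PlanarTree.IsInsertion T j S X} :=
  map₂_setSum (Brace.comp j) (R := fun T S => {X | PlanarTree.IsInsertion T j S X})
    (Brace.comp_of j) (fun h h' => h.unique h') A B

theorem Brace.map_of (σ : I ≃ J) (T : PlanarTree I) :
    Brace.map σ (of T) = of (T.map σ) := map_of_apply _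

theorem Brace.map_setSum (σ : I ≃ J) (A : Set (PlanarTree I)) :
    Brace.map σ (setSum A) = setSum {X | X.map σ.symm ∈ A} :=
  map_equiv_setSum (PlanarTree.map σ.symm)
    (fun T => by rw [T.map_map, σ.self_trans_symm, T.map_refl])
    (fun T => by rw [T.map_map, σ.symm_trans_self, T.map_refl]) A

end comp

/-! ## The operad `Brace` -/

namespace PlanarTree

variable {I J K I' J' : Type}

theorem isInsertion_map (σ : J ≃ J') (τ : I ≃ I') (j : J) (T : PlanarTree J) (S : PlanarTree I)
    (X : PlanarTree ({x : J' // x ≠ σ j} ⊕ I')) :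
    IsInsertion (T.map σ) (σ j) (S.map τ) X ↔ IsInsertion T j S (X.map (Equiv.sumCongr
      (σ.subtypeEquiv (p := fun x => x ≠ j) (q := fun x => x ≠ σ j)
        fun _ => not_congr σ.injective.eq_iff.symm) τ).symm) := by
  -- Relabelling carries roots to roots; the remaining conditions are transported literally.
  have hroot : ∀ {r}, (∀ s, S.Above s r) ↔ ∀ s, (S.map τ).Above s (τ r) := fun {r} => by
    simp only [above_map, Equiv.symm_apply_apply, τ.symm.forall_congr_left, Equiv.symm_symm]
  have hne : ∀ x : {x : J' // x ≠ σ j}, σ.symm x.1 ≠ j := fun x h =>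
    x.2 (σ.symm_apply_eq.1 h)
  constructor
  · rintro ⟨⟨h₁, h₂, h₃, h₄⟩, h₅, h₆, h₇, h₈⟩
    refine ⟨⟨fun x y => ?_, fun s t => ?_, fun s x => ?_, fun x r hr => ?_⟩, fun x y => ?_,
      fun s t => ?_, fun x r hr => ?_, fun x r hr => ?_⟩
    · exact (above_map _ _ _ _).trans ((h₁ ⟨σ x, fun e => x.2 (σ.injective e)⟩
        ⟨σ y, fun e => y.2 (σ.injective e)⟩).trans (by simp [above_map]))
    · exact (above_map _ _ _ _).trans ((h₂ (τ s) (τ t)).trans (by simp [above_map]))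
    · exact (above_map _ _ _ _).trans ((h₃ (τ s) ⟨σ x, fun e => x.2 (σ.injective e)⟩).trans
        (by simp [above_map]))
    · exact (above_map _ _ _ _).trans ((h₄ ⟨σ x, fun e => x.2 (σ.injective e)⟩
        (hroot.1 hr)).trans (by simp [above_map]))
    · exact (leftOf_map _ _ _ _).trans ((h₅ ⟨σ x, fun e => x.2 (σ.injective e)⟩
        ⟨σ y, fun e => y.2 (σ.injective e)⟩).trans (by simp [leftOf_map]))
    · exact (leftOf_map _ _ _ _).trans ((h₆ (τ s) (τ t)).trans (by simp [leftOf_map]))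
    · exact (leftOf_map _ _ _ _).trans ((h₇ ⟨σ x, fun e => x.2 (σ.injective e)⟩
        (hroot.1 hr)).trans (by simp [leftOf_map]))
    · exact (leftOf_map _ _ _ _).trans ((h₈ ⟨σ x, fun e => x.2 (σ.injective e)⟩
        (hroot.1 hr)).trans (by simp [leftOf_map]))
  · rintro ⟨⟨h₁, h₂, h₃, h₄⟩, h₅, h₆, h₇, h₈⟩
    have hroot' : ∀ {r}, (∀ s, (S.map τ).Above s r) → ∀ s, S.Above s (τ.symm r) :=
      fun {r} h => hroot.2 (by rwa [τ.apply_symm_apply])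
    refine ⟨⟨fun x y => ?_, fun s t => ?_, fun s x => ?_, fun x r hr => ?_⟩, fun x y => ?_,
      fun s t => ?_, fun x r hr => ?_, fun x r hr => ?_⟩
    · refine Iff.trans ?_ ((h₁ ⟨_, hne x⟩ ⟨_, hne y⟩).trans (above_map T σ _ _).symm)
      refine Iff.trans ?_ (above_map X _ _ _).symm
      simp
    · refine Iff.trans ?_ ((h₂ (τ.symm s) (τ.symm t)).trans (above_map S τ _ _).symm)
      refine Iff.trans ?_ (above_map X _ _ _).symm
      simp
    · refine Iff.trans ?_ ((h₃ (τ.symm s) ⟨_, hne x⟩).trans ?_)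
      · refine Iff.trans ?_ (above_map X _ _ _).symm
        simp
      · simp [above_map]
    · refine Iff.trans ?_ ((h₄ ⟨_, hne x⟩ (hroot' hr)).trans ?_)
      · refine Iff.trans ?_ (above_map X _ _ _).symm
        simp
      · simp [above_map]
    · refine Iff.trans ?_ ((h₅ ⟨_, hne x⟩ ⟨_, hne y⟩).trans (leftOf_map T σ _ _).symm)
      refine Iff.trans ?_ (leftOf_map X _ _ _).symm
      simp
    · refine Iff.trans ?_ ((h₆ (τ.symm s) (τ.symm t)).trans (leftOf_map S τ _ _).symm)
      refine Iff.trans ?_ (leftOf_map X _ _ _).symm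
      simp
    · refine Iff.trans ?_ ((h₇ ⟨_, hne x⟩ (hroot' hr)).trans ?_)
      · refine Iff.trans ?_ (leftOf_map X _ _ _).symm
        simp
      · simp [leftOf_map]
    · refine Iff.trans ?_ ((h₈ ⟨_, hne x⟩ (hroot' hr)).trans ?_)
      · refine Iff.trans ?_ (leftOf_map X _ _ _).symm
        simp
      · simp [leftOf_map]

theorem isInsertion_point_left (S X) :
    IsInsertion point () S X ↔ X.map (OperadData.unitLeftEquiv I).symm = S := by
  constructor
  · intro h
    exact ext_rel (fun a b => (above_map _ _ _ _).trans (h.above.inr_inr a b))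
      fun a b => (leftOf_map _ _ _ _).trans (h.inr_inr a b)
  · rintro rfl
    exact ⟨⟨fun x => absurd rfl x.2, fun s t =>
      (above_map X (OperadData.unitLeftEquiv I).symm s t).symm,
      fun _ x => absurd rfl x.2, fun x => absurd rfl x.2⟩, fun x => absurd rfl x.2,
      fun s t => (leftOf_map X (OperadData.unitLeftEquiv I).symm s t).symm,
      fun x => absurd rfl x.2, fun x => absurd rfl x.2⟩

theorem isInsertion_point_right (j : J) (T X) :
    IsInsertion T j point X ↔ X.map (OperadData.unitRightEquiv j).symm = T := by
  have hroot : ∀ s, point.Above s () := fun _ => point.above_refl _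
  constructor
  · intro h
    have hsub : ∀ a : J, a = j ∨ ∃ x : {x : J // x ≠ j}, a = x := fun a =>
      or_iff_not_imp_left.2 fun h => ⟨⟨a, h⟩, rfl⟩
    have hj : (OperadData.unitRightEquiv j) j = .inr () := by simp [OperadData.unitRightEquiv]
    have hx : ∀ x : {x : J // x ≠ j}, (OperadData.unitRightEquiv j) x.1 = .inl x := fun x => by
      simp [OperadData.unitRightEquiv, x.2]
    refine ext_rel (fun a b => ?_) fun a b => ?_
    · rw [above_map, Equiv.symm_symm]
      rcases hsub a with rfl | ⟨x, rfl⟩ <;> rcases hsub b with rfl | ⟨y, rfl⟩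
      · simp [NonplanarTree.above_refl]
      · rw [hj, hx, h.above.inr_inl]
      · rw [hj, hx, h.above.inl_inr x hroot]
      · rw [hx, hx, h.above.inl_inl]
    · rw [leftOf_map, Equiv.symm_symm]
      rcases hsub a with rfl | ⟨x, rfl⟩ <;> rcases hsub b with rfl | ⟨y, rfl⟩
      · simp [leftOf_irrefl]
      · rw [hj, hx, h.inr_inl y hroot]
      · rw [hj, hx, h.inl_inr x hroot]
      · rw [hx, hx, h.inl_inl]
  · rintro rfl
    have hj : (OperadData.unitRightEquiv j) j = .inr () := by simp [OperadData.unitRightEquiv]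
    have hx : ∀ x : {x : J // x ≠ j}, (OperadData.unitRightEquiv j) x.1 = .inl x := fun x => by
      simp [OperadData.unitRightEquiv, x.2]
    refine ⟨⟨fun x y => ?_, fun s t => ?_, fun s x => ?_, fun x r hr => ?_⟩, fun x y => ?_,
      fun s t => ?_, fun x r hr => ?_, fun x r hr => ?_⟩
    · rw [above_map, Equiv.symm_symm, hx, hx]
    · simp [NonplanarTree.above_refl]
    · rw [above_map, Equiv.symm_symm, hx, hj]
    · rw [above_map, Equiv.symm_symm, hx, hj]
    · rw [leftOf_map, Equiv.symm_symm, hx, hx]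
    · simp [leftOf_irrefl]
    · rw [leftOf_map, Equiv.symm_symm, hx, hj]
    · rw [leftOf_map, Equiv.symm_symm, hx, hj]

end PlanarTree

/-! ### Sequential and parallel associativity for planar insertions -/

namespace NonplanarTree

variable {I J : Type}

/-- The root is unique, so the conditions at the root of `S` may be checked at one given vertex `r`.
-/
theorem IsInsertion.mk_of_root {T : NonplanarTree J} {j : J} {S : NonplanarTree I}
    {X : NonplanarTree ({x : J // x ≠ j} ⊕ I)} {r : I} (hr : ∀ s, S.Above s r)
    (h₁ : ∀ x y, X.Above (.inl x) (.inl y) ↔ T.Above x.1 y.1)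
    (h₂ : ∀ s t, X.Above (.inr s) (.inr t) ↔ S.Above s t)
    (h₃ : ∀ s x, X.Above (.inr s) (.inl x) ↔ T.Above j x.1)
    (h₄ : ∀ x, X.Above (.inl x) (.inr r) ↔ T.Above x.1 j) : IsInsertion T j S X :=
  ⟨h₁, h₂, h₃, fun x _ hq => S.root_unique hr hq ▸ h₄ x⟩

theorem expand_injective (j : J) (r : I) : Function.Injective (expand j r) := by
  intro x y h
  by_cases hx : x = j <;> by_cases hy : y = j <;> simp_all [expand]

theorem IsInsertion.root {T : NonplanarTree J} {j : J} {S : NonplanarTree I}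
    {X : NonplanarTree ({x : J // x ≠ j} ⊕ I)} (h : IsInsertion T j S X) {q : J}
    (hq : ∀ x, T.Above x q) {r : I} (hr : ∀ s, S.Above s r) (a) : X.Above a (expand j r q) := by
  by_cases e : q = j
  · subst e
    rw [expand_self]
    rcases a with x | s
    · exact (h.inl_inr x hr).2 (hq _)
    · exact (h.inr_inr s r).2 (hr _)
  · rw [expand_of_ne j r e]
    rcases a with x | s
    · exact (h.inl_inl x _).2 (hq _)
    · exact (h.inr_inl s _).2 (hq _)

end NonplanarTree

namespace PlanarTree

open NonplanarTree (expand expand_self expand_of_ne expand_val expand_injective)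

variable {I J K : Type}

theorem IsInsertion.mk_of_root {T : PlanarTree J} {j : J} {S : PlanarTree I}
    {X : PlanarTree ({x : J // x ≠ j} ⊕ I)} {r : I} (hr : ∀ s, S.Above s r)
    (h₁ : ∀ x y, X.Above (.inl x) (.inl y) ↔ T.Above x.1 y.1)
    (h₂ : ∀ s t, X.Above (.inr s) (.inr t) ↔ S.Above s t)
    (h₃ : ∀ s x, X.Above (.inr s) (.inl x) ↔ T.Above j x.1)
    (h₄ : ∀ x, X.Above (.inl x) (.inr r) ↔ T.Above x.1 j)
    (h₅ : ∀ x y, X.LeftOf (.inl x) (.inl y) ↔ T.LeftOf x.1 y.1)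
    (h₆ : ∀ s t, X.LeftOf (.inr s) (.inr t) ↔ S.LeftOf s t)
    (h₇ : ∀ x, X.LeftOf (.inr r) (.inl x) ↔ T.LeftOf j x.1)
    (h₈ : ∀ x, X.LeftOf (.inl x) (.inr r) ↔ T.LeftOf x.1 j) : IsInsertion T j S X :=
  ⟨.mk_of_root hr h₁ h₂ h₃ h₄, h₅, h₆, fun x _ hq => S.root_unique hr hq ▸ h₇ x,
    fun x _ hq => S.root_unique hr hq ▸ h₈ x⟩

/-- `Z` is forced to be the restriction of `X` to the vertices coming from `S` and `U`. Its smallest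
vertex is the root of `S`, or that of `U` if `i` is the root of `S`; this accounts for the cases `r
= i`. -/
theorem exists_isInsertion_of_seq [Finite I] [Finite K] {j : J} {i : I} {T : PlanarTree J}
    {S : PlanarTree I} {U : PlanarTree K} {Y} {X : PlanarTree _} (hY : IsInsertion T j S Y)
    (hX : IsInsertion Y (.inr i) U X) :
    ∃ Z, IsInsertion S i U Z ∧ IsInsertion T j Z (X.map (OperadData.seqEquiv K j i).symm) := by
  obtain ⟨r, hr⟩ := S.exists_forall_above
  obtain ⟨u, hu⟩ := U.exists_forall_above
  set e := OperadData.seqEquiv K j i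
  have eV : ∀ a b, (X.map e.symm).Above a b ↔ X.Above (e a) (e b) := fun a b => by
    rw [above_map, Equiv.symm_symm]
  have eH : ∀ a b, (X.map e.symm).LeftOf a b ↔ X.LeftOf (e a) (e b) := fun a b => by
    rw [leftOf_map, Equiv.symm_symm]
  have hV₁ : ∀ y y' : {y : I // y ≠ i}, X.Above (e (.inr (.inl y))) (e (.inr (.inl y'))) ↔
      S.Above y.1 y'.1 := fun y y' => (hX.above.inl_inl _ _).trans (hY.above.inr_inr _ _)
  have hV₂ : ∀ k k' : K, X.Above (e (.inr (.inr k))) (e (.inr (.inr k'))) ↔ U.Above k k' :=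
    hX.above.inr_inr
  have hV₃ : ∀ (k : K) (y : {y : I // y ≠ i}), X.Above (e (.inr (.inr k))) (e (.inr (.inl y))) ↔
      S.Above i y.1 := fun k y => (hX.above.inr_inl _ _).trans (hY.above.inr_inr _ _)
  have hV₄ : ∀ y : {y : I // y ≠ i}, X.Above (e (.inr (.inl y))) (e (.inr (.inr u))) ↔
      S.Above y.1 i := fun y => (hX.above.inl_inr _ hu).trans (hY.above.inr_inr _ _)
  have hroot : ∀ a, X.Above (e (.inr a)) (e (.inr (expand i u r))) := by
    intro a
    by_cases hri : r = i
    · subst hri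
      rw [expand_self]
      rcases a with y | k
      · exact (hV₄ y).2 (hr _)
      · exact (hV₂ k u).2 (hu _)
    · rw [expand_of_ne i u hri]
      rcases a with y | k
      · exact (hV₁ y _).2 (hr _)
      · exact (hV₃ k _).2 (hr _)
  obtain ⟨Z, hZV, hZH⟩ := X.exists_restrict (ι := fun a => e (.inr a))
    (e.injective.comp Sum.inr_injective) (expand i u r) hroot
  have hZroot : ∀ a, Z.Above a (expand i u r) := fun a => (hZV _ _).2 (hroot a)
  refine ⟨Z, .mk_of_root hu (fun y y' => (hZV _ _).trans (hV₁ y y'))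
    (fun k k' => (hZV _ _).trans (hV₂ k k')) (fun k y => (hZV _ _).trans (hV₃ k y))
    (fun y => (hZV _ _).trans (hV₄ y))
    (fun y y' => (hZH _ _).trans ((hX.inl_inl _ _).trans (hY.inr_inr _ _)))
    (fun k k' => (hZH _ _).trans (hX.inr_inr _ _))
    (fun y => (hZH _ _).trans ((hX.inr_inl _ hu).trans (hY.inr_inr _ _)))
    (fun y => (hZH _ _).trans ((hX.inl_inr _ hu).trans (hY.inr_inr _ _))),
    .mk_of_root hZroot
    (fun x y => (eV _ _).trans ((hX.above.inl_inl _ _).trans (hY.above.inl_inl _ _)))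
    (fun a b => (eV _ _).trans (hZV a b).symm) ?_ ?_
    (fun x y => (eH _ _).trans ((hX.inl_inl _ _).trans (hY.inl_inl _ _)))
    (fun a b => (eH _ _).trans (hZH a b).symm) ?_ ?_⟩
  · rintro (y | k) x
    · exact (eV _ _).trans ((hX.above.inl_inl _ _).trans (hY.above.inr_inl _ _))
    · exact (eV _ _).trans ((hX.above.inr_inl _ _).trans (hY.above.inr_inl _ _))
  · intro x
    rw [eV]
    by_cases hri : r = i
    · subst hri
      rw [expand_self]
      exact (hX.above.inl_inr _ hu).trans (hY.above.inl_inr _ hr)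
    · rw [expand_of_ne i u hri]
      exact (hX.above.inl_inl _ _).trans (hY.above.inl_inr _ hr)
  · intro x
    rw [eH]
    by_cases hri : r = i
    · subst hri
      rw [expand_self]
      exact (hX.inr_inl _ hu).trans (hY.inr_inl _ hr)
    · rw [expand_of_ne i u hri]
      exact (hX.inl_inl _ _).trans (hY.inr_inl _ hr)
  · intro x
    rw [eH]
    by_cases hri : r = i
    · subst hri
      rw [expand_self]
      exact (hX.inl_inr _ hu).trans (hY.inl_inr _ hr)
    · rw [expand_of_ne i u hri]
      exact (hX.inl_inl _ _).trans (hY.inl_inr _ hr)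

/-- `Y` is the restriction of `X` in which `U` is represented by its root `u`, standing for `i`. The
conditions on `Y` are then those on `T` and `Z`, with `i` read as `u`. -/
theorem exists_isInsertion_seq_of [Finite I] [Finite J] {j : J} {i : I} {T : PlanarTree J}
    {S : PlanarTree I} {U : PlanarTree K} {Z} {X : PlanarTree _} (hZ : IsInsertion S i U Z)
    (hX : IsInsertion T j Z (X.map (OperadData.seqEquiv K j i).symm)) :
    ∃ Y, IsInsertion T j S Y ∧ IsInsertion Y (.inr i) U X := by
  obtain ⟨q, hq⟩ := T.exists_forall_above
  obtain ⟨r, hr⟩ := S.exists_forall_above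
  obtain ⟨u, hu⟩ := U.exists_forall_above
  set e := OperadData.seqEquiv K j i
  have eV : ∀ {a b}, X.Above (e a) (e b) ↔ (X.map e.symm).Above a b := fun {a b} => by
    rw [above_map, Equiv.symm_symm]
  have eH : ∀ {a b}, X.LeftOf (e a) (e b) ↔ (X.map e.symm).LeftOf a b := fun {a b} => by
    rw [leftOf_map, Equiv.symm_symm]
  have hZr := hZ.above.root hr hu
  have ex : ∀ x : {x : J // x ≠ j}, expand (.inr i) u (.inl x : {x : J // x ≠ j} ⊕ I) =
      e (.inl x) := fun x => expand_of_ne _ _ Sum.inl_ne_inr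
  have ei : expand (.inr i) u (.inr i : {x : J // x ≠ j} ⊕ I) = e (.inr (.inr u)) :=
    expand_self _ _
  have ey : ∀ y : {y : I // y ≠ i}, expand (.inr i) u (.inr y.1 : {x : J // x ≠ j} ⊕ I) =
      e (.inr (.inl y)) := fun y => expand_of_ne _ _ fun h => y.2 (Sum.inr_injective h)
  have ey' : ∀ y : I, expand (.inr i) u (.inr y : {x : J // x ≠ j} ⊕ I) =
      e (.inr (expand i u y)) := by
    intro y
    by_cases hy : y = i
    · subst hy
      rw [ei, expand_self]
    · rw [expand_of_ne i u hy]
      exact ey ⟨y, hy⟩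
  have hroot : ∀ a : {x : J // x ≠ j} ⊕ I,
      X.Above (expand (.inr i) u a) (expand (.inr i) u (expand j r q)) := by
    intro a
    have key : ∃ b, expand (.inr i) u a = e b := by
      rcases a with x | y
      · exact ⟨_, ex x⟩
      · exact ⟨_, ey' y⟩
    obtain ⟨b, hb⟩ := key
    have := hX.above.root hq hZr b
    rw [hb]
    by_cases hqj : q = j
    · subst hqj
      rw [expand_self] at this ⊢
      rw [ey']
      exact eV.2 this
    · rw [expand_of_ne j _ hqj] at this ⊢
      rw [ex]
      exact eV.2 this
  obtain ⟨Y, hYV, hYH⟩ := X.exists_restrict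
    (expand_injective (Sum.inr i : {x : J // x ≠ j} ⊕ I) u) (expand j r q) hroot
  have hsub : ∀ a : I, a = i ∨ ∃ x : {x : I // x ≠ i}, a = x := fun a =>
    or_iff_not_imp_left.2 fun h => ⟨⟨a, h⟩, rfl⟩
  refine ⟨Y, .mk_of_root hr (fun x y => ?_) (fun s t => ?_) (fun s x => ?_) (fun x => ?_)
    (fun x y => ?_) (fun s t => ?_) (fun x => ?_) (fun x => ?_),
    .mk_of_root hu (fun z z' => ?_) (fun k k' => ?_) (fun k z => ?_) (fun z => ?_)
    (fun z z' => ?_) (fun k k' => ?_) (fun z => ?_) (fun z => ?_)⟩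
  · rw [hYV, ex, ex, eV, hX.above.inl_inl]
  · rw [hYV, ey', ey', eV, hX.above.inr_inr]
    rcases hsub s with rfl | ⟨s, rfl⟩ <;> rcases hsub t with rfl | ⟨t, rfl⟩
    · simp only [NonplanarTree.above_refl]
    · rw [expand_self, expand_val, hZ.above.inr_inl]
    · rw [expand_self, expand_val, hZ.above.inl_inr s hu]
    · rw [expand_val, expand_val, hZ.above.inl_inl]
  · rw [hYV, ey', ex, eV, hX.above.inr_inl]
  · rw [hYV, ey', ex, eV, hX.above.inl_inr x hZr]
  · rw [hYH, ex, ex, eH, hX.inl_inl]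
  · rw [hYH, ey', ey', eH, hX.inr_inr]
    rcases hsub s with rfl | ⟨s, rfl⟩ <;> rcases hsub t with rfl | ⟨t, rfl⟩
    · simp only [leftOf_irrefl]
    · rw [expand_self, expand_val, hZ.inr_inl t hu]
    · rw [expand_self, expand_val, hZ.inl_inr s hu]
    · rw [expand_val, expand_val, hZ.inl_inl]
  · rw [hYH, ey', ex, eH, hX.inr_inl x hZr]
  · rw [hYH, ey', ex, eH, hX.inl_inr x hZr]
  · rw [hYV, expand_val, expand_val]
  · exact (eV (a := .inr (.inr k)) (b := .inr (.inr k'))).trans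
      ((hX.above.inr_inr _ _).trans (hZ.above.inr_inr _ _))
  · rw [hYV, ei, expand_val]
    rcases z with ⟨x | y, hz⟩
    · refine (eV (a := .inr (.inr k)) (b := .inl x)).trans (Iff.trans ?_
        (eV (a := .inr (.inr u)) (b := .inl x)).symm)
      rw [hX.above.inr_inl, hX.above.inr_inl]
    · have hy : y ≠ i := fun h => hz (congrArg Sum.inr h)
      refine (eV (a := .inr (.inr k)) (b := .inr (.inl ⟨y, hy⟩))).trans (Iff.trans ?_
        (eV (a := .inr (.inr u)) (b := .inr (.inl ⟨y, hy⟩))).symm)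
      rw [hX.above.inr_inr, hX.above.inr_inr, hZ.above.inr_inl, hZ.above.inr_inl]
  · rw [hYV, expand_self, expand_val]
  · rw [hYH, expand_val, expand_val]
  · exact (eH (a := .inr (.inr k)) (b := .inr (.inr k'))).trans
      ((hX.inr_inr _ _).trans (hZ.inr_inr _ _))
  · rw [hYH, expand_self, expand_val]
  · rw [hYH, expand_self, expand_val]

/-- `Z` is the restriction of `X` in which `S` is represented by its root `r`, standing for `j`,
while `U` is kept entirely. -/
theorem exists_isInsertion_par [Finite J] [Finite K] {j k : J} (h : k ≠ j)
    {T : PlanarTree J} {S : PlanarTree I} {U : PlanarTree K} {Y} {X : PlanarTree _}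
    (hY : IsInsertion T j S Y) (hX : IsInsertion Y (.inl ⟨k, h⟩) U X) :
    ∃ Z, IsInsertion T k U Z ∧
      IsInsertion Z (.inl ⟨j, h.symm⟩) S (X.map (OperadData.parEquiv I K h).symm) := by
  obtain ⟨r, hr⟩ := S.exists_forall_above
  obtain ⟨u, hu⟩ := U.exists_forall_above
  set e := OperadData.parEquiv I K h
  have eV : ∀ {a b}, (X.map e.symm).Above a b ↔ X.Above (e a) (e b) := fun {a b} => by
    rw [above_map, Equiv.symm_symm]
  have eH : ∀ {a b}, (X.map e.symm).LeftOf a b ↔ X.LeftOf (e a) (e b) := fun {a b} => by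
    rw [leftOf_map, Equiv.symm_symm]
  have hsub : ∀ x : {x : J // x ≠ k}, x = (⟨j, h.symm⟩ : {x : J // x ≠ k}) ∨
      ∃ (h₁ : x.1 ≠ j) (h₂ : (⟨x.1, h₁⟩ : {x : J // x ≠ j}) ≠ ⟨k, h⟩),
      e (expand (Sum.inl ⟨j, h.symm⟩ : {x : J // x ≠ k} ⊕ K) r (.inl x)) =
        .inl ⟨.inl ⟨x.1, h₁⟩, fun h => h₂ (Sum.inl_injective h)⟩ := by
    intro x
    refine or_iff_not_imp_left.2 fun hx => ?_
    have h₁ : x.1 ≠ j := fun e => hx (Subtype.ext e)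
    refine ⟨h₁, fun e => x.2 (congrArg Subtype.val e), ?_⟩
    rw [expand_of_ne _ _ fun e => hx (Sum.inl_injective e)]
    rfl
  have ej : e (expand (Sum.inl ⟨j, h.symm⟩ : {x : J // x ≠ k} ⊕ K) r
      (Sum.inl ⟨j, h.symm⟩ : {x : J // x ≠ k} ⊕ K)) = .inl ⟨.inr r, Sum.inr_ne_inl⟩ := by
    rw [expand_self]
    rfl
  have eu : ∀ v, e (expand (Sum.inl ⟨j, h.symm⟩ : {x : J // x ≠ k} ⊕ K) r (.inr v)) = .inr v := by
    intro v
    rw [expand_of_ne _ _ Sum.inr_ne_inl]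
    rfl
  obtain ⟨q', hq'⟩ := (X.map e.symm).exists_forall_above
  -- If the smallest vertex lies in `S`, it is the root of `S`; so it is always among the vertices
  -- kept.
  have hroot : ∃ p, expand (Sum.inl ⟨j, h.symm⟩ : {x : J // x ≠ k} ⊕ K) r p = q' := by
    rcases q' with z | s
    · exact ⟨z, expand_val _ _ z⟩
    · refine ⟨.inl ⟨j, h.symm⟩, ?_⟩
      rw [expand_self, S.root_unique hr fun t => ?_]
      exact (hY.above.inr_inr t s).1 ((hX.above.inl_inl ⟨.inr t, Sum.inr_ne_inl⟩
        ⟨.inr s, Sum.inr_ne_inl⟩).1 (eV.1 (hq' (.inr t))))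
  obtain ⟨p, rfl⟩ := hroot
  obtain ⟨Z, hZV, hZH⟩ := (X.map e.symm).exists_restrict
    (expand_injective (Sum.inl ⟨j, h.symm⟩ : {x : J // x ≠ k} ⊕ K) r) p
    fun a => hq' _
  refine ⟨Z, .mk_of_root hu (fun x y => ?_) (fun s t => ?_) (fun s x => ?_) (fun x => ?_)
    (fun x y => ?_) (fun s t => ?_) (fun x => ?_) (fun x => ?_),
    .mk_of_root hr (fun z z' => ?_) (fun k k' => ?_) (fun s z => ?_) (fun z => ?_)
    (fun z z' => ?_) (fun k k' => ?_) (fun z => ?_) (fun z => ?_)⟩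
  · rw [hZV, eV]
    rcases hsub x with rfl | ⟨_, _, ex⟩ <;> rcases hsub y with rfl | ⟨_, _, ey⟩
    · simp only [NonplanarTree.above_refl]
    · rw [ej, ey, hX.above.inl_inl, hY.above.inr_inl]
    · rw [ej, ex, hX.above.inl_inl, hY.above.inl_inr _ hr]
    · rw [ex, ey, hX.above.inl_inl, hY.above.inl_inl]
  · rw [hZV, eV, eu, eu, hX.above.inr_inr]
  · rw [hZV, eV, eu]
    rcases hsub x with rfl | ⟨_, _, ex⟩
    · rw [ej, hX.above.inr_inl, hY.above.inl_inr _ hr]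
    · rw [ex, hX.above.inr_inl, hY.above.inl_inl]
  · rw [hZV, eV, eu]
    rcases hsub x with rfl | ⟨_, _, ex⟩
    · rw [ej, hX.above.inl_inr _ hu, hY.above.inr_inl]
    · rw [ex, hX.above.inl_inr _ hu, hY.above.inl_inl]
  · rw [hZH, eH]
    rcases hsub x with rfl | ⟨_, _, ex⟩ <;> rcases hsub y with rfl | ⟨_, _, ey⟩
    · simp only [leftOf_irrefl]
    · rw [ej, ey, hX.inl_inl, hY.inr_inl _ hr]
    · rw [ej, ex, hX.inl_inl, hY.inl_inr _ hr]
    · rw [ex, ey, hX.inl_inl, hY.inl_inl]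
  · rw [hZH, eH, eu, eu, hX.inr_inr]
  · rw [hZH, eH, eu]
    rcases hsub x with rfl | ⟨_, _, ex⟩
    · rw [ej, hX.inr_inl _ hu, hY.inl_inr _ hr]
    · rw [ex, hX.inr_inl _ hu, hY.inl_inl]
  · rw [hZH, eH, eu]
    rcases hsub x with rfl | ⟨_, _, ex⟩
    · rw [ej, hX.inl_inr _ hu, hY.inr_inl _ hr]
    · rw [ex, hX.inl_inr _ hu, hY.inl_inl]
  · rw [hZV, expand_val, expand_val]
  · exact eV.trans ((hX.above.inl_inl _ _).trans (hY.above.inr_inr _ _))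
  · rw [hZV, eV, eV, ej]
    have es : e (.inr s) = .inl ⟨.inr s, Sum.inr_ne_inl⟩ := rfl
    rw [es]
    rcases z with ⟨x | v, hz⟩
    · rcases hsub x with rfl | ⟨_, _, ex⟩
      · exact absurd rfl hz
      · rw [ex, hX.above.inl_inl, hY.above.inr_inl,
          ← expand_val (Sum.inl ⟨j, h.symm⟩ : {x : J // x ≠ k} ⊕ K) r, ex,
          hX.above.inl_inl, hY.above.inr_inl]
    · rw [eu, ← expand_val (Sum.inl ⟨j, h.symm⟩ : {x : J // x ≠ k} ⊕ K) r, eu]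
      -- The vertices `r` and `v` are both below `s`, hence comparable. If `v` were above `r`, then
      -- `k` would be above `j`, while `s` above `v` gives `j` above `k`, against `k ≠ j`.
      have hsr : X.Above (.inl ⟨.inr s, Sum.inr_ne_inl⟩) (.inl ⟨.inr r, Sum.inr_ne_inl⟩) :=
        (hX.above.inl_inl _ _).2 ((hY.above.inr_inr s r).2 (hr s))
      refine ⟨fun hsv => (X.above_total hsr hsv).resolve_right fun hvr => h ?_,
        fun hrv => X.above_trans hsr hrv⟩
      refine T.above_antisymm ?_ ?_
      · exact (hY.above.inl_inr _ hr).1 ((hX.above.inr_inl _ _).1 hvr)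
      · exact (hY.above.inr_inl _ _).1 (hX.above.above_inr hsv)
  · rw [hZV, expand_self, expand_val]
  · rw [hZH, expand_val, expand_val]
  · exact eH.trans ((hX.inl_inl _ _).trans (hY.inr_inr _ _))
  · rw [hZH, expand_self, expand_val]
  · rw [hZH, expand_self, expand_val]

end PlanarTree

/-! ### The operad axioms for `Brace`, reduced to basis elements -/

section

open FreeAbelianGroup

variable {I J K : Type} [Finite I] [Nonempty I] [Finite J] [Nonempty J] [Finite K] [Nonempty K]

@[elab_as_elim]
theorem Brace.induction {p : Brace.obj I → Prop} (zero : p 0) (of : ∀ T : PlanarTree I, p (of T))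
    (neg : ∀ x, p x → p (-x)) (add : ∀ x y, p x → p y → p (x + y)) (a : Brace.obj I) : p a :=
  FreeAbelianGroup.induction_on a zero of (fun T _ => neg _ (of T)) add

theorem Brace.comp_map_of {I' J' : Type} [Finite I'] [Nonempty I'] [Finite J'] [Nonempty J']
    (σ : J ≃ J') (τ : I ≃ I') (j : J) (T : PlanarTree J) (S : PlanarTree I) :
    Brace.comp (σ j) (Brace.map σ (of T)) (Brace.map τ (of S)) =
      Brace.map (Equiv.sumCongr
        (σ.subtypeEquiv (p := fun x => x ≠ j) (q := fun x => x ≠ σ j)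
          fun _ => not_congr σ.injective.eq_iff.symm) τ) (Brace.comp j (of T) (of S)) := by
  rw [map_of, map_of, comp_of, comp_of, map_setSum]
  congr 1
  ext X
  exact PlanarTree.isInsertion_map σ τ j T S X

theorem Brace.comp_assoc_of (j : J) (i : I) (T : PlanarTree J) (S : PlanarTree I)
    (U : PlanarTree K) :
    Brace.comp (.inr i) (Brace.comp j (of T) (of S)) (of U) =
      Brace.map (OperadData.seqEquiv K j i) (Brace.comp j (of T) (Brace.comp i (of S) (of U))) := by
  rw [comp_of, comp_of, ← setSum_singleton U, comp_setSum, ← setSum_singleton T, comp_setSum,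
    map_setSum]
  congr 1
  ext X
  constructor
  · rintro ⟨Y, hY, U, rfl, hX⟩
    obtain ⟨Z, hZ, hX⟩ := PlanarTree.exists_isInsertion_of_seq hY hX
    exact ⟨T, rfl, Z, hZ, hX⟩
  · rintro ⟨T, rfl, Z, hZ, hX⟩
    obtain ⟨Y, hY, hX⟩ := PlanarTree.exists_isInsertion_seq_of hZ hX
    exact ⟨Y, hY, U, rfl, hX⟩

theorem Brace.comp_comm_of {j k : J} (h : k ≠ j) (T : PlanarTree J) (S : PlanarTree I)
    (U : PlanarTree K) :
    Brace.comp (.inl ⟨k, h⟩) (Brace.comp j (of T) (of S)) (of U) =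
      Brace.map (OperadData.parEquiv I K h)
        (Brace.comp (.inl ⟨j, h.symm⟩) (Brace.comp k (of T) (of U)) (of S)) := by
  rw [comp_of, comp_of, ← setSum_singleton U, comp_setSum, ← setSum_singleton S, comp_setSum,
    map_setSum]
  congr 1
  ext X
  constructor
  · rintro ⟨Y, hY, U, rfl, hX⟩
    obtain ⟨Z, hZ, hX⟩ := PlanarTree.exists_isInsertion_par h hY hX
    exact ⟨Z, hZ, S, rfl, hX⟩
  · rintro ⟨Z, hZ, S, rfl, hX⟩
    -- The situation is symmetric under exchanging `j`, `S` with `k`, `U`, and the exchange turns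
    -- `parEquiv` into its inverse.
    obtain ⟨Y, hY, hX⟩ := PlanarTree.exists_isInsertion_par h.symm hZ hX
    refine ⟨Y, hY, U, rfl, ?_⟩
    rw [PlanarTree.map_map] at hX
    have e : (OperadData.parEquiv I K h).symm.trans (OperadData.parEquiv K I h.symm).symm =
        Equiv.refl _ := (OperadData.parEquiv I K h).symm_trans_self
    rwa [e] at hX

theorem Brace.isOperad : Brace.IsOperad where
  map_refl a := by
    induction a using Brace.induction with
    | zero => rw [map_zero]
    | of T => rw [Brace.map_of, T.map_refl]
    | neg x hx => rw [map_neg, hx]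
    | add x y hx hy => rw [map_add, hx, hy]
  map_trans σ τ a := by
    induction a using Brace.induction with
    | zero => simp only [map_zero]
    | of T => rw [Brace.map_of, Brace.map_of, Brace.map_of, T.map_map]
    | neg x hx => simp only [map_neg, hx]
    | add x y hx hy => simp only [map_add, hx, hy]
  comp_map σ τ j a b := by
    induction a using Brace.induction with
    | zero => simp only [map_zero, AddMonoidHom.zero_apply]
    | neg x hx => simp only [map_neg, AddMonoidHom.neg_apply, hx]
    | add x y hx hy => simp only [map_add, AddMonoidHom.add_apply, hx, hy]
    | of T =>
      induction b using Brace.induction with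
      | zero => simp only [map_zero]
      | neg x hx => simp only [map_neg, hx]
      | add x y hx hy => simp only [map_add, hx, hy]
      | of S => exact Brace.comp_map_of σ τ j T S
  unit_comp b := by
    induction b using Brace.induction with
    | zero => simp only [map_zero]
    | neg x hx => simp only [map_neg, hx]
    | add x y hx hy => simp only [map_add, hx, hy]
    | of S =>
      refine (Brace.comp_of _ _ _).trans ?_
      rw [← setSum_singleton S, Brace.map_setSum]
      congr 1
      ext X
      exact PlanarTree.isInsertion_point_left S X
  comp_unit j a := by
    induction a using Brace.induction with
    | zero => simp only [map_zero, AddMonoidHom.zero_apply]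
    | neg x hx => simp only [map_neg, AddMonoidHom.neg_apply, hx]
    | add x y hx hy => simp only [map_add, AddMonoidHom.add_apply, hx, hy]
    | of T =>
      refine (Brace.comp_of _ _ _).trans ?_
      rw [← setSum_singleton T, Brace.map_setSum]
      congr 1
      ext X
      exact PlanarTree.isInsertion_point_right j T X
  comp_assoc j i a b c := by
    induction a using Brace.induction with
    | zero => simp only [map_zero, AddMonoidHom.zero_apply]
    | neg x hx => simp only [map_neg, AddMonoidHom.neg_apply, hx]
    | add x y hx hy => simp only [map_add, AddMonoidHom.add_apply, hx, hy]
    | of T =>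
      induction b using Brace.induction with
      | zero => simp only [map_zero, AddMonoidHom.zero_apply]
      | neg x hx => simp only [map_neg, AddMonoidHom.neg_apply, hx]
      | add x y hx hy => simp only [map_add, AddMonoidHom.add_apply, hx, hy]
      | of S =>
        induction c using Brace.induction with
        | zero => simp only [map_zero]
        | neg x hx => simp only [map_neg, hx]
        | add x y hx hy => simp only [map_add, hx, hy]
        | of U => exact Brace.comp_assoc_of j i T S U
  comp_comm h a b c := by
    induction a using Brace.induction with
    | zero => simp only [map_zero, AddMonoidHom.zero_apply]
    | neg x hx => simp only [map_neg, AddMonoidHom.neg_apply, hx]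
    | add x y hx hy => simp only [map_add, AddMonoidHom.add_apply, hx, hy]
    | of T =>
      induction b using Brace.induction with
      | zero => simp only [map_zero, AddMonoidHom.zero_apply]
      | neg x hx => simp only [map_neg, AddMonoidHom.neg_apply, hx]
      | add x y hx hy => simp only [map_add, AddMonoidHom.add_apply, hx, hy]
      | of S =>
        obtain ⟨b, hb⟩ : ∃ b : Brace.obj _, b = of S := ⟨_, rfl⟩
        rw [← hb]
        induction c using Brace.induction with
        | zero => simp only [map_zero, AddMonoidHom.zero_apply]
        | neg x hx => simp only [map_neg, AddMonoidHom.neg_apply, hx]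
        | add x y hx hy => simp only [map_add, AddMonoidHom.add_apply, hx, hy]
        | of U => exact hb ▸ Brace.comp_comm_of h T S U

end

/-! ## Symmetrization -/

namespace OperadData

/-- A structure that embeds into an operad is an operad. -/
theorem Hom.isOperad_of_injective {P Q : OperadData} (φ : Hom P Q)
    (hφ : ∀ (I : Type) [Finite I] [Nonempty I], Function.Injective (φ.app I)) (hQ : Q.IsOperad) :
    P.IsOperad where
  map_refl a := hφ _ (by rw [φ.app_map, hQ.map_refl])
  map_trans σ τ a := hφ _ (by rw [φ.app_map, φ.app_map, φ.app_map, hQ.map_trans])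
  comp_map σ τ j a b := hφ _ (by
    rw [φ.app_comp, φ.app_map, φ.app_map, φ.app_map, φ.app_comp, hQ.comp_map])
  unit_comp b := hφ _ (by rw [φ.app_comp, φ.app_unit, φ.app_map, hQ.unit_comp])
  comp_unit j a := hφ _ (by rw [φ.app_comp, φ.app_unit, φ.app_map, hQ.comp_unit])
  comp_assoc j i a b c := hφ _ (by
    rw [φ.app_comp, φ.app_comp, φ.app_map, φ.app_comp, φ.app_comp, hQ.comp_assoc])
  comp_comm h a b c := hφ _ (by
    rw [φ.app_comp, φ.app_comp, φ.app_map, φ.app_comp, φ.app_comp, hQ.comp_comm])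

end OperadData

/-- Every rooted tree has a planar structure. -/
theorem NonplanarTree.exists_planarTree {I : Type} (T : NonplanarTree I) :
    ∃ P : PlanarTree I, P.toNonplanarTree = T :=
  ⟨{ toNonplanarTree := T
     left := fun a b => (∃ s, T.edge a s ∧ T.edge b s) ∧ WellOrderingRel a b
     siblings_of_left := fun h => h.1
     left_irrefl := fun a h => irrefl_of WellOrderingRel a h.2
     left_trans := by
       rintro a b c ⟨⟨s, ha, hb⟩, h⟩ ⟨⟨t, hb', hc⟩, h'⟩
       cases T.edge_unique hb hb'
       exact ⟨⟨s, ha, hc⟩, trans_of WellOrderingRel h h'⟩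
     left_total := by
       intro a b s ha hb hne
       rcases trichotomous_of WellOrderingRel a b with h | h | h
       · exact .inl ⟨⟨s, ha, hb⟩, h⟩
       · exact absurd h hne
       · exact .inr ⟨⟨s, hb, ha⟩, h⟩ }, rfl⟩

/-- The planar structures on `S` and `T` are induced from `X`, the root of `S` standing for `j`.
This is the reason why symmetrization respects compositions. -/
theorem PlanarTree.exists_isInsertion_of_nonplanar {I J : Type} [Finite I] [Finite J] {j : J}
    {T : NonplanarTree J} {S : NonplanarTree I} {X : PlanarTree ({x : J // x ≠ j} ⊕ I)}
    (h : NonplanarTree.IsInsertion T j S X.toNonplanarTree) :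
    ∃ T' : PlanarTree J, T'.toNonplanarTree = T ∧ ∃ S' : PlanarTree I, S'.toNonplanarTree = S ∧
      IsInsertion T' j S' X := by
  obtain ⟨q, hq⟩ := T.exists_forall_above
  obtain ⟨r, hr⟩ := S.exists_forall_above
  obtain ⟨S', hV, hH⟩ := X.exists_restrict (ι := Sum.inr) Sum.inr_injective r
    fun s => (h.inr_inr s r).2 (hr s)
  obtain ⟨T', hV', hH'⟩ := X.exists_restrict (NonplanarTree.expand_injective j r) q
    fun x => h.root hq hr _
  have eS : S'.toNonplanarTree = S :=
    NonplanarTree.ext_above fun a b => (hV a b).trans (h.inr_inr a b)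
  have hsub : ∀ a : J, a = j ∨ ∃ x : {x : J // x ≠ j}, a = x := fun a =>
    or_iff_not_imp_left.2 fun h => ⟨⟨a, h⟩, rfl⟩
  have eT : T'.toNonplanarTree = T := by
    refine NonplanarTree.ext_above fun a b => (hV' a b).trans ?_
    rcases hsub a with rfl | ⟨x, rfl⟩ <;> rcases hsub b with rfl | ⟨y, rfl⟩
    · simp only [NonplanarTree.above_refl]
    · rw [NonplanarTree.expand_self, NonplanarTree.expand_val, h.inr_inl]
    · rw [NonplanarTree.expand_self, NonplanarTree.expand_val, h.inl_inr x hr]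
    · rw [NonplanarTree.expand_val, NonplanarTree.expand_val, h.inl_inl]
  have hr' : ∀ {p}, (∀ s, S'.Above s p) → r = p := fun {p} hp =>
    S.root_unique hr (eS ▸ hp)
  refine ⟨T', eT, S', eS, by rwa [eT, eS], fun x y => ?_, fun s t => (hH s t).symm,
    fun x p hp => ?_, fun x p hp => ?_⟩
  · rw [hH', NonplanarTree.expand_val, NonplanarTree.expand_val]
  · rw [hH', NonplanarTree.expand_self, NonplanarTree.expand_val, hr' hp]
  · rw [hH', NonplanarTree.expand_self, NonplanarTree.expand_val, hr' hp]

/-! ### Symmetrization as an injective morphism of operads -/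

section

open FreeAbelianGroup

variable {I J : Type} [Finite I] [Nonempty I] [Finite J] [Nonempty J]

@[elab_as_elim]
theorem PreLie.induction {p : PreLie.obj I → Prop} (zero : p 0)
    (of : ∀ T : NonplanarTree I, p (of T)) (neg : ∀ x, p x → p (-x))
    (add : ∀ x y, p x → p y → p (x + y)) (a : PreLie.obj I) : p a :=
  FreeAbelianGroup.induction_on a zero of (fun T _ => neg _ (of T)) add

theorem symmetrization_eq_setSum (T : NonplanarTree I) :
    symmetrization T = setSum {P : PlanarTree I | P.toNonplanarTree = T} := by
  let := Fintype.ofFinite {P : PlanarTree I // P.toNonplanarTree = T}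
  have h := sum_of_eq_setSum
    (Subtype.val_injective (p := fun P : PlanarTree I => P.toNonplanarTree = T))
  exact h.trans (congrArg setSum Subtype.range_coe)

/-- The additive extension of the symmetrization of trees. -/
noncomputable def symmetrizationHom (I : Type) [Finite I] [Nonempty I] :
    PreLie.obj I →+ Brace.obj I :=
  FreeAbelianGroup.lift symmetrization

theorem symmetrizationHom_of (T : NonplanarTree I) :
    symmetrizationHom I (of T) = symmetrization T :=
  lift_apply_of _ _

theorem symmetrizationHom_setSum (A : Set (NonplanarTree I)) :
    symmetrizationHom I (setSum A) = setSum {P : PlanarTree I | P.toNonplanarTree ∈ A} := by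
  refine (map_setSum (symmetrizationHom I)
    (R := fun T => {P : PlanarTree I | P.toNonplanarTree = T})
    (fun T => (symmetrizationHom_of T).trans (symmetrization_eq_setSum T))
    (fun h h' => h.symm.trans h') A).trans ?_
  congr 1
  ext P
  simp

/-- A left inverse: choose one planar structure `c T` on every `T`, send `c T` back to `T`, and send
all other planar trees to zero. -/
theorem symmetrizationHom_injective : Function.Injective (symmetrizationHom I) := by
  choose c hc using fun T : NonplanarTree I => T.exists_planarTree
  let g : FreeAbelianGroup (PlanarTree I) →+ FreeAbelianGroup (NonplanarTree I) :=
    lift fun P => setSum {T | c T = P}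
  refine Function.LeftInverse.injective (g := g) fun a => ?_
  induction a using PreLie.induction with
  | zero => rw [map_zero]; exact map_zero g
  | neg x hx => rw [map_neg]; exact (map_neg g _).trans (congrArg _ hx)
  | add x y hx hy => rw [map_add]; exact (map_add g _ _).trans (congrArg₂ _ hx hy)
  | of T =>
    rw [symmetrizationHom_of, symmetrization_eq_setSum, ← setSum_singleton]
    refine (map_setSum g (R := fun P => {T | c T = P}) (fun P => lift_apply_of _ _)
      (fun h h' => h.symm.trans h') _).trans ?_
    congr 1
    ext T'
    constructor
    · rintro ⟨P, rfl, rfl⟩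
      exact (hc T').symm
    · rintro rfl
      exact ⟨_, hc _, rfl⟩

/-- Both sides are sums over sets of planar trees. An insertion of planar trees has an insertion
underlying it; conversely, planar structures on the factors are induced from that of the result. -/
theorem symmetrizationHom_comp_of (j : J) (T : NonplanarTree J) (S : NonplanarTree I) :
    symmetrizationHom _ (PreLie.comp j (of T) (of S)) =
      Brace.comp j (symmetrizationHom J (of T)) (symmetrizationHom I (of S)) := by
  rw [PreLie.comp_of, symmetrizationHom_setSum, symmetrizationHom_of, symmetrizationHom_of,
    symmetrization_eq_setSum, symmetrization_eq_setSum, Brace.comp_setSum]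
  congr 1
  ext X
  constructor
  · exact fun h => PlanarTree.exists_isInsertion_of_nonplanar h
  · rintro ⟨T, rfl, S, rfl, h⟩
    exact h.above

/-- The symmetrization of trees is a morphism of operads. -/
noncomputable def symmetrizationMorphism : OperadData.Hom PreLie Brace where
  app := symmetrizationHom
  app_map σ a := by
    induction a using PreLie.induction with
    | zero => simp only [map_zero]
    | neg x hx => simp only [map_neg, hx]
    | add x y hx hy => simp only [map_add, hx, hy]
    | of T =>
      rw [← setSum_singleton, PreLie.map_setSum, symmetrizationHom_setSum,
        symmetrizationHom_setSum, Brace.map_setSum]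
      rfl
  app_unit := by
    refine (symmetrizationHom_of NonplanarTree.point).trans ?_
    rw [symmetrization_eq_setSum]
    refine Eq.trans ?_ (setSum_singleton PlanarTree.point)
    congr 1
    ext P
    refine ⟨fun h => PlanarTree.ext_rel (fun a b => ?_) fun a b => ?_, fun h => h ▸ rfl⟩
    · rw [h]
      rfl
    · simp only [PlanarTree.leftOf_irrefl]
  app_comp j a b := by
    induction a using PreLie.induction with
    | zero => simp only [map_zero, AddMonoidHom.zero_apply]
    | neg x hx => simp only [map_neg, AddMonoidHom.neg_apply, hx]
    | add x y hx hy => simp only [map_add, AddMonoidHom.add_apply, hx, hy]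
    | of T =>
      induction b using PreLie.induction with
      | zero => simp only [map_zero]
      | neg x hx => simp only [map_neg, hx]
      | add x y hx hy => simp only [map_add, hx, hy]
      | of S => exact symmetrizationHom_comp_of j T S

theorem symmetrizationMorphism_preLieProduct :
    symmetrizationMorphism.app (Fin 2) preLieProduct = braceProduct := by
  refine (symmetrizationHom_of NonplanarTree.edge01).trans ?_
  rw [symmetrization_eq_setSum]
  refine Eq.trans ?_ (setSum_singleton PlanarTree.corolla01)
  congr 1
  ext P
  refine ⟨fun h => PlanarTree.ext (congrArg NonplanarTree.edge h) ?_, fun h => h ▸ rfl⟩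
  ext a b
  refine ⟨fun hab => ?_, fun h => h.elim⟩
  -- The vertex `1` is the only one with a successor, so there are no distinct siblings to order.
  obtain ⟨s, hs, hs'⟩ := P.siblings_of_left hab
  rw [h] at hs hs'
  rw [hs.1, hs'.1] at hab
  exact absurd hab (P.left_irrefl _)

theorem PreLie.isOperad : PreLie.IsOperad :=
  symmetrizationMorphism.isOperad_of_injective (fun _ _ _ => symmetrizationHom_injective)
    Brace.isOperad

end

/-! ## Generation of `PreLie` by its product -/

namespace NonplanarTree

variable {I : Type} (T : NonplanarTree I) {c r : I}

/-- The vertices of the tree obtained by grafting the subtree above `c` on the rest of `T`. -/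
noncomputable def graftEquiv (c : I) :
    {z : {x : Fin 2 // x ≠ 0} ⊕ {x : I // ¬ T.Above x c} // z ≠ .inl ⟨1, one_ne_zero⟩} ⊕
      {x : I // T.Above x c} ≃ I :=
  Equiv.ofBijective
    (Sum.elim (fun z => Sum.elim (fun _ => c) Subtype.val z.1) Subtype.val) (by
      constructor
      · rintro (⟨x | b, h⟩ | a) (⟨x' | b', h'⟩ | a') e
        · exact absurd (congrArg Sum.inl (Subtype.ext (Fin.eq_one_of_ne_zero x.1 x.2))) h
        · exact absurd (congrArg Sum.inl (Subtype.ext (Fin.eq_one_of_ne_zero x.1 x.2))) h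
        · exact absurd (congrArg Sum.inl (Subtype.ext (Fin.eq_one_of_ne_zero x.1 x.2))) h
        · exact absurd (congrArg Sum.inl (Subtype.ext (Fin.eq_one_of_ne_zero x'.1 x'.2))) h'
        · have e : b = b' := Subtype.ext e
          subst e
          rfl
        · have e : b.1 = a'.1 := e
          exact absurd (e ▸ a'.2) b.2
        · exact absurd (congrArg Sum.inl (Subtype.ext (Fin.eq_one_of_ne_zero x'.1 x'.2))) h'
        · have e : a.1 = b'.1 := e
          exact absurd (e ▸ a.2) b'.2
        · exact congrArg Sum.inr (Subtype.ext e)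
      · intro x
        by_cases h : T.Above x c
        · exact ⟨.inr ⟨x, h⟩, rfl⟩
        · exact ⟨.inl ⟨.inr ⟨x, h⟩, Sum.inr_ne_inl⟩, rfl⟩)

variable {T} {A : NonplanarTree {x : I // T.Above x c}} {B : NonplanarTree {x : I // ¬ T.Above x c}}

/-- `X` is obtained by grafting the subtree `A` of `T` above `c` on a vertex of the rest `B`. -/
def IsGraft (A : NonplanarTree {x : I // T.Above x c})
    (B : NonplanarTree {x : I // ¬ T.Above x c}) (X : NonplanarTree I) : Prop :=
  ∃ Y, IsInsertion edge01 0 B Y ∧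
    IsInsertion Y (.inl ⟨1, one_ne_zero⟩) A (X.map (T.graftEquiv c).symm)

theorem not_edge01_above : ¬ edge01.Above 0 1 := fun h =>
  absurd (edge01.eq_of_above_of_isRoot h fun _ h => absurd h.1 (by decide)) (by decide)

theorem edge01_above : edge01.Above 1 0 := edge01.above_of_edge ⟨rfl, rfl⟩

section

variable (hc : T.edge c r) (hr : ∀ a, T.Above a r)
  (hA : ∀ a b, A.Above a b ↔ T.Above a.1 b.1) (hB : ∀ a b, B.Above a b ↔ T.Above a.1 b.1)

include hc hr hA hB

/-- In `T` the branch `A` hangs on the root, so the relations of `T` between `A` and `B` only say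
that `A` is above the root. Every other grafting satisfies these too. -/
theorem IsGraft.above_of_above {X : NonplanarTree I} (hX : IsGraft A B X) {a b : I}
    (h : T.Above a b) : X.Above a b := by
  obtain ⟨Y, hY, hX⟩ := hX
  have eV : ∀ {a b}, (X.map (T.graftEquiv c).symm).Above a b ↔
      X.Above (T.graftEquiv c a) (T.graftEquiv c b) := fun {a b} => by
    rw [above_map, Equiv.symm_symm]
  have hBr : ∀ s, B.Above s ⟨r, T.not_above_of_edge hc⟩ := fun s => (hB _ _).2 (hr _)
  by_cases ha : T.Above a c <;> by_cases hb : T.Above b c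
  · exact (eV (a := .inr ⟨a, ha⟩) (b := .inr ⟨b, hb⟩)).1 ((hX.inr_inr _ _).2 ((hA _ _).2 h))
  · have hcb : T.Above c b := (T.above_total ha h).resolve_right hb
    have hrb : T.Above r b := T.above_of_edge_of_ne hc hcb fun e => hb (e ▸ T.above_refl _)
    cases T.above_antisymm hrb (hr b)
    exact (eV (a := .inr ⟨a, ha⟩) (b := .inl ⟨.inr ⟨r, hb⟩, Sum.inr_ne_inl⟩)).1
      ((hX.inr_inl _ _).2 ((hY.inl_inr _ hBr).2 edge01_above))
  · exact absurd (T.above_trans h hb) ha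
  · exact (eV (a := .inl ⟨.inr ⟨a, ha⟩, Sum.inr_ne_inl⟩)
      (b := .inl ⟨.inr ⟨b, hb⟩, Sum.inr_ne_inl⟩)).1
      ((hX.inl_inl _ _).2 ((hY.inr_inr _ _).2 ((hB _ _).2 h)))

/-- The intermediate tree `Y` is the restriction of `T` to `B` together with `c`, the vertex `1` of
`edge01` standing for `c`. -/
theorem isGraft_self [Finite I] : IsGraft A B T := by
  have hrB : ¬ T.Above r c := T.not_above_of_edge hc
  have hBr : ∀ s, B.Above s ⟨r, hrB⟩ := fun s => (hB _ _).2 (hr _)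
  have hAc : ∀ s, A.Above s ⟨c, T.above_refl c⟩ := fun s => (hA _ _).2 s.2
  have h1 : ∀ x : {x : Fin 2 // x ≠ 0}, x = ⟨1, one_ne_zero⟩ := fun x =>
    Subtype.ext (Fin.eq_one_of_ne_zero x.1 x.2)
  have hι : Function.Injective (Sum.elim (fun _ => c) Subtype.val :
      {x : Fin 2 // x ≠ 0} ⊕ {x : I // ¬ T.Above x c} → I) := by
    rintro (x | b) (x' | b') e
    · rw [h1 x, h1 x']
    · exact absurd (Eq.mp (congrArg (fun x => T.Above x c) e) (T.above_refl c)) b'.2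
    · exact absurd (Eq.mpr (congrArg (fun x => T.Above x c) e) (T.above_refl c)) b.2
    · exact congrArg Sum.inr (Subtype.ext e)
  obtain ⟨Y, hY⟩ := T.exists_restrict hι (.inr ⟨r, hrB⟩) fun a => hr _
  have eV : ∀ {a b}, (T.map (T.graftEquiv c).symm).Above a b ↔
      T.Above (T.graftEquiv c a) (T.graftEquiv c b) := fun {a b} => by
    rw [above_map, Equiv.symm_symm]
  refine ⟨Y, .mk_of_root hBr (fun x y => ?_) (fun s t => (hY _ _).trans (hB s t).symm)
    (fun s x => ?_) fun x => ?_, .mk_of_root hAc ?_ (fun s t => eV.trans (hA s t).symm) ?_ ?_⟩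
  · rw [h1 x, h1 y]
    simp only [above_refl]
  · rw [h1 x]
    exact iff_of_false (fun h => s.2 ((hY _ _).1 h)) not_edge01_above
  · rw [h1 x]
    exact iff_of_true ((hY _ _).2 (hr _)) edge01_above
  · rintro ⟨x | b, h⟩ ⟨x' | b', h'⟩
    · exact absurd (congrArg Sum.inl (h1 x)) h
    · exact absurd (congrArg Sum.inl (h1 x)) h
    · exact absurd (congrArg Sum.inl (h1 x')) h'
    · exact eV.trans (hY (.inr b) (.inr b')).symm
  · rintro a ⟨x | b, h⟩
    · exact absurd (congrArg Sum.inl (h1 x)) h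
    · refine eV.trans (Iff.trans ?_ (hY _ _).symm)
      exact ⟨fun h => (T.above_total a.2 h).resolve_right b.2, fun h => T.above_trans a.2 h⟩
  · rintro ⟨x | b, h⟩
    · exact absurd (congrArg Sum.inl (h1 x)) h
    · exact eV.trans (hY (.inr b) (.inl ⟨1, one_ne_zero⟩)).symm

end

/-- The inclusion of the orders is strict because the order determines the tree. This count is the
measure of the inner induction below. -/
theorem card_not_above_lt [Finite I] {T X : NonplanarTree I}
    (h : ∀ a b, T.Above a b → X.Above a b) (hne : X ≠ T) :
    {p : I × I | ¬ X.Above p.1 p.2}.ncard < {p : I × I | ¬ T.Above p.1 p.2}.ncard := by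
  refine Set.ncard_lt_ncard ⟨fun p hp hT => hp (h _ _ hT), fun hsub => hne ?_⟩ (Set.toFinite _)
  refine ext_above fun a b => ⟨fun hX => ?_, h a b⟩
  by_contra hT
  exact hsub (show (a, b) ∈ {p : I × I | ¬ T.Above p.1 p.2} from hT) hX

end NonplanarTree

/-! ### Morphisms from `PreLie` are determined on the product -/

section

open FreeAbelianGroup NonplanarTree

variable {I : Type} [Finite I] [Nonempty I]

theorem PreLie.comp_comp_edge01 {T : NonplanarTree I} {c : I} [Nonempty {x : I // T.Above x c}]
    [Nonempty {x : I // ¬ T.Above x c}] (A : NonplanarTree {x : I // T.Above x c})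
    (B : NonplanarTree {x : I // ¬ T.Above x c}) :
    PreLie.map (T.graftEquiv c) (PreLie.comp (.inl ⟨1, one_ne_zero⟩)
      (PreLie.comp 0 preLieProduct (of B)) (of A)) = setSum {X | IsGraft A B X} := by
  rw [preLieProduct, PreLie.comp_of, ← setSum_singleton A, PreLie.comp_setSum, PreLie.map_setSum]
  congr 1
  ext X
  constructor
  · rintro ⟨Y, hY, A, rfl, hX⟩
    exact ⟨Y, hY, hX⟩
  · rintro ⟨Y, hY, hX⟩
    exact ⟨Y, hY, A, rfl, hX⟩

namespace OperadData.Hom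

theorem app_map_congr {P Q : OperadData} {φ ψ : Hom P Q} {J : Type} [Finite J] [Nonempty J]
    (σ : I ≃ J) {a : P.obj I} (ha : φ.app I a = ψ.app I a) :
    φ.app J (P.map σ a) = ψ.app J (P.map σ a) := by
  rw [φ.app_map, ψ.app_map, ha]

theorem app_comp_congr {P Q : OperadData} {φ ψ : Hom P Q} {J : Type} [Finite J] [Nonempty J]
    (j : J) {a : P.obj J} {b : P.obj I} (ha : φ.app J a = ψ.app J a)
    (hb : φ.app I b = ψ.app I b) : φ.app _ (P.comp j a b) = ψ.app _ (P.comp j a b) := by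
  rw [φ.app_comp, ψ.app_comp, ha, hb]

/-- Outer induction on the number of vertices handles the branch `A` and the rest `B`; inner
induction on the number of pairs not in relation `Above` handles all graftings of `A` on `B` other
than `T`. -/
theorem eq_of_eq_preLieProduct_of {Q : OperadData} {φ ψ : Hom PreLie Q}
    (h : φ.app (Fin 2) preLieProduct = ψ.app (Fin 2) preLieProduct) (n : ℕ) :
    ∀ (I : Type) [Finite I] [Nonempty I], Nat.card I = n → ∀ T : NonplanarTree I,
      φ.app I (of T) = ψ.app I (of T) := by
  induction n using Nat.strong_induction_on with
  | _ n ih =>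
    intro I _ _ hn T
    generalize hm : {p : I × I | ¬ T.Above p.1 p.2}.ncard = m
    induction m using Nat.strong_induction_on generalizing T with
    | _ m ihm =>
      obtain ⟨r, hr⟩ := T.exists_forall_above
      by_cases hc : ∃ c, T.edge c r
      · obtain ⟨c, hc⟩ := hc
        have hrc : ¬ T.Above r c := T.not_above_of_edge hc
        have : Nonempty {x : I // T.Above x c} := ⟨⟨c, T.above_refl c⟩⟩
        have : Nonempty {x : I // ¬ T.Above x c} := ⟨⟨r, hrc⟩⟩
        obtain ⟨A, hA⟩ := T.exists_restrict
          (Subtype.val_injective (p := fun x => T.Above x c)) ⟨c, T.above_refl c⟩ fun a => a.2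
        obtain ⟨B, hB⟩ := T.exists_restrict
          (Subtype.val_injective (p := fun x => ¬ T.Above x c)) ⟨r, hrc⟩ fun a => hr _
        have hA' := ih _ (hn ▸ Finite.card_subtype_lt hrc) _ rfl A
        have hB' := ih _ (hn ▸ Finite.card_subtype_lt (not_not_intro (T.above_refl c))) _ rfl B
        -- The sum of all graftings is built from the product, `B` and `A` by compositions and a
        -- relabelling, and both morphisms agree on these three.
        have hsum : φ.app I (setSum {X | IsGraft A B X}) =
            ψ.app I (setSum {X | IsGraft A B X}) := by
          rw [← PreLie.comp_comp_edge01]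
          exact app_map_congr _ (app_comp_congr _ (app_comp_congr 0 h hB') hA')
        have hrest : φ.app I (setSum ({X | IsGraft A B X} \ {T})) =
            ψ.app I (setSum ({X | IsGraft A B X} \ {T})) := by
          have key : ∀ χ : Hom PreLie Q, χ.app I (setSum ({X | IsGraft A B X} \ {T})) =
              ∑ᶠ X ∈ ({X | IsGraft A B X} \ {T} : Set _), χ.app I (of X) := fun χ =>
            AddMonoidHom.map_finsum_mem (M := PreLie.obj I) _ (χ.app I) (Set.toFinite _)
          rw [key, key]
          refine finsum_mem_congr rfl fun X hX => ihm _ ?_ X rfl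
          rw [← hm]
          exact card_not_above_lt
            (fun a b => IsGraft.above_of_above hc hr hA hB hX.1) hX.2
        have hT : T ∈ {X | IsGraft A B X} := isGraft_self hc hr hA hB
        rw [setSum_eq_add_of_mem hT] at hsum
        -- The other graftings contribute equally on both sides, so they cancel and the term of `T`
        -- remains.
        have hsum := (map_add (φ.app I) _ _).symm.trans (hsum.trans (map_add (ψ.app I) _ _))
        rw [hrest] at hsum
        exact add_right_cancel hsum
      -- No edge enters the root, so `T` has a single vertex and is a relabelling of the operadic
      -- unit.
      · have hall : ∀ a, a = r := fun a => by
          rcases Relation.ReflTransGen.cases_tail (hr a) with e | ⟨c, _, h⟩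
          · exact e.symm
          · exact absurd ⟨c, h⟩ hc
        let e : Unit ≃ I := ⟨fun _ => r, fun _ => (), fun _ => rfl, fun a => (hall a).symm⟩
        have eT : PreLie.map e PreLie.unit = of T := by
          refine (PreLie.map_of e point).trans (congrArg of (ext_above fun a b => ?_))
          rw [hall a, hall b]
          simp only [above_refl]
        rw [← eT, φ.app_map, ψ.app_map, φ.app_unit, ψ.app_unit]

/-- A morphism from `PreLie` is determined by the image of the product. -/
theorem eq_of_eq_preLieProduct {Q : OperadData} {φ ψ : Hom PreLie Q}
    (h : φ.app (Fin 2) preLieProduct = ψ.app (Fin 2) preLieProduct) : φ = ψ := by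
  ext I _ _ a
  induction a using PreLie.induction with
  | zero => simp only [map_zero]
  | neg x hx => simp only [map_neg, hx]
  | add x y hx hy => simp only [map_add, hx, hy]
  | of T => exact eq_of_eq_preLieProduct_of h _ I rfl T

end OperadData.Hom

end

theorem mainTheorem9 :
    PreLie.IsOperad ∧ Brace.IsOperad ∧
    ∃ φ : OperadData.Hom PreLie Brace,
      φ.app (Fin 2) preLieProduct = braceProduct ∧
      (∀ ψ : OperadData.Hom PreLie Brace, ψ.app (Fin 2) preLieProduct = braceProduct → ψ = φ) ∧
      ∀ (I : Type) [Finite I] [Nonempty I] (T : NonplanarTree I),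
        φ.app I (FreeAbelianGroup.of T) = symmetrization T :=
  ⟨PreLie.isOperad, Brace.isOperad, symmetrizationMorphism, symmetrizationMorphism_preLieProduct,
    fun _ hψ => OperadData.Hom.eq_of_eq_preLieProduct
      (hψ.trans symmetrizationMorphism_preLieProduct.symm),
    fun _ _ _ T => symmetrizationHom_of T⟩
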